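/- Fix pairwise disjoint sets $\mathbf V$ (variables, infinite), $\mathbf N$ (names), $\mathbf I$ (agents) and $\mathbf P$ (predicate symbols, each with an arity in $\mathbb N$). Terms are $t::=x\mid a$ with $x\in\mathbf V$, $a\in\mathbf N$, and formulas are $$\varphi::=t\approx t'\mid P\vec t\mid(\varphi\wedge\varphi)\mid\neg\varphi\mid\mathsf K_i\varphi\mid[x:=t]\varphi .$$ The connectives $\to,\leftrightarrow,\top$ are the usual abbreviations and $\langle x:=t\rangle\varphi:=\neg[x:=t]\neg\varphi$. The operator $[x:=t]$ binds $x$ in $\varphi$, but the occurrence of $t$ in it is not bound: $\mathsf{Fv}([x:=t]\varphi)=(\mathsf{Fv}(\varphi)\setminus\{x\})\cup\mathsf{Var}(t)$. By $\varphi[y/x]$ we denote the result of replacing all free occurrences of $x$ in $\varphi$ by $y$; it is admissible if none of the new occurrences of $y$ is bound. A (constant domain) Kripke model $\mathcal M=\langle W,D,R,\rho,\eta\rangle$ has a non-empty set $W$ of worlds, a non-empty domain $D$, a binary relation $R_i$ on $W$ for each $i\in\mathbf I$, a relation $\rho(P,w)\subseteq D^n$ for each $n$-ary $P\in\mathbf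 P$ and $w\in W$, and an object $\eta(a,w)\in D$ for each $a\in\mathbf N$ and $w\in W$. It is an epistemic model if every $R_i$ is an equivalence relation. For $\sigma:\mathbf V\to D$ let $\sigma_w(x)=\sigma(x)$ and $\sigma_w(a)=\eta(a,w)$. Truth is defined by: $\mathcal M,w,\sigma\vDash t\approx t'$ iff $\sigma_w(t)=\sigma_w(t')$; $\mathcal M,w,\sigma\vDash P t_1\cdots t_n$ iff $(\sigma_w(t_1),\dots,\sigma_w(t_n))\in\rho(P,w)$; the usual clauses for $\neg$ and $\wedge$; $\mathcal M,w,\sigma\vDash\mathsf K_i\varphi$ iff $\mathcal M,v,\sigma\vDash\varphi$ for all $v$ with $wR_iv$; $\mathcal M,w,\sigma\vDash[x:=t]\varphi$ iff $\mathcal M,w,\sigma[x\mapsto\sigma_w(t)]\vDash\varphi$. The system $\mathsf{SBELAS}$ has as axioms all instances of propositional tautologies and all formulas of the forms (with $x,y\in\mathbf V$ and $t,t',t''$ terms) - $\mathsf K_i(\varphi\to\psi)\to(\mathsf K_i\varphi\to\mathsf K_i\psi)$; - $t\approx t$; $\ t\approx t'\leftrightarrow t'\approx t$; $\ t\approx t'\wedge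 t'\approx t''\to t\approx t''$; - $t\approx t'\to([x:=t]\varphi\leftrightarrow[x:=t']\varphi)$; $\ \bigwedge_k t_k\approx t'_k\to(P\vec t\leftrightarrow P\vec t')$; - $x\approx y\to\mathsf K_i\,x\approx y$; $\ \neg\, x\approx y\to\mathsf K_i\neg\, x\approx y$; - $[x:=t](\varphi\to\psi)\to([x:=t]\varphi\to[x:=t]\psi)$; $\ \langle x:=t\rangle\varphi\to[x:=t]\varphi$; $\ \langle x:=t\rangle\top$; $\ [x:=t]\,x\approx t$; - $\varphi[y/x]\to[x:=y]\varphi$, where $\varphi[y/x]$ is admissible; and the rules: from $\varphi$ infer $\mathsf K_i\varphi$; from $\varphi$ and $\varphi\to\psi$ infer $\psi$; from $\varphi\to\psi$ infer $\varphi\to[x:=t]\psi$, provided that $x\notin\mathsf{Fv}(\varphi)$. The system $\mathsf{SBELAS5}$ has the additional axioms $\mathsf K_i\varphi\to\varphi$, $\ \mathsf K_i\varphi\to\mathsf K_i\mathsf K_i\varphi$ and $\neg\mathsf K_i\varphi\to\mathsf K_i\neg\mathsf K_i\varphi$. For a set $\Gamma$ of formulas, $\Gamma\vdash\varphi$ means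 that there are $\psi_1,\dots,\psi_n\in\Gamma$ ($n\ge 0$) such that $(\psi_1\wedge\dots\wedge\psi_n)\to\varphi$ is a theorem of the system. For a class $\mathcal C$ of models, $\Gamma\vDash_{\mathcal C}\varphi$ means that for all $\mathcal M\in\mathcal C$, all worlds $w$ of $\mathcal M$ and all $\sigma$, if $\mathcal M,w,\sigma\vDash\psi$ for all $\psi\in\Gamma$, then $\mathcal M,w,\sigma\vDash\varphi$. **Theorem.** $\mathsf{SBELAS}$ is strongly complete over the class of all Kripke models, and $\mathsf{SBELAS5}$ is strongly complete over the class of epistemic models. That is, for every (possibly infinite) set $\Gamma$ of formulas and every formula $\varphi$: 1. if $\Gamma\vDash_{\mathcal C}\varphi$ for the class $\mathcal C$ of all Kripke models, then $\Gamma\vdash_{\mathsf{SBELAS}}\varphi$; 2. if $\Gamma\vDash_{\mathcal C}\varphi$ for the class $\mathcal C$ of epistemic models, then $\Gamma\vdash_{\mathsf{SBELAS5}}\varphi$. -/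

import Mathlib

universe u

namespace BELAS

/-- The non-logical vocabulary: variables, names, agents, and predicate symbols with arities.
The supply of variables is infinite, the other sets are arbitrary (they may be empty). -/
structure Signature where
  Var : Type u
  Name : Type u
  Agent : Type u
  Pred : Type u
  arity : Pred → ℕ
  infinite_var : Infinite Var

attribute [instance] Signature.infinite_var

variable {S : Signature.{u}}

/-! ### Syntax -/

/-- Terms `t ::= x | a`. -/
inductive Term (S : Signature.{u}) : Type u where
  | var (x : S.Var) : Term S
  | name (a : S.Name) : Term S

/-- Formulas `φ ::= t ≈ t' | P t₁ … tₙ | (φ ∧ φ) | ¬ φ | K_i φ | [x := t] φ`. -/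
inductive Formula (S : Signature.{u}) : Type u where
  | eq (t t' : Term S) : Formula S
  | pred (P : S.Pred) (ts : Fin (S.arity P) → Term S) : Formula S
  | and (φ ψ : Formula S) : Formula S
  | neg (φ : Formula S) : Formula S
  | know (i : S.Agent) (φ : Formula S) : Formula S
  | assign (x : S.Var) (t : Term S) (φ : Formula S) : Formula S

namespace Formula

/-- `φ → ψ`, an abbreviation of `¬ (φ ∧ ¬ ψ)`. -/
def imp (φ ψ : Formula S) : Formula S := neg (Formula.and φ (neg ψ))

/-- `φ ↔ ψ`. -/
def iff (φ ψ : Formula S) : Formula S := Formula.and (imp φ ψ) (imp ψ φ)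

/-- `⟨x := t⟩ φ`, the dual of `[x := t] φ`. -/
def dualAssign (x : S.Var) (t : Term S) (φ : Formula S) : Formula S :=
  neg (assign x t (neg φ))

/-- `⊤`, an abbreviation of the tautology `p → p` for a fixed atomic formula `p`. -/
noncomputable def top : Formula S :=
  imp (eq (Term.var (Classical.arbitrary S.Var)) (Term.var (Classical.arbitrary S.Var)))
    (eq (Term.var (Classical.arbitrary S.Var)) (Term.var (Classical.arbitrary S.Var)))

/-- The conjunction of a finite list of formulas; the empty conjunction is `⊤`. -/
noncomputable def conj : List (Formula S) → Formula S
  | [] => top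
  | φ :: L => Formula.and φ (conj L)

end Formula

open Formula

/-- The set of variables of a term. -/
def Term.vars : Term S → Set S.Var
  | Term.var x => {x}
  | Term.name _ => ∅

/-- The set of free variables of a formula. -/
def Formula.fv : Formula S → Set S.Var
  | .eq t t' => t.vars ∪ t'.vars
  | .pred _ ts => ⋃ k, (ts k).vars
  | .and φ ψ => φ.fv ∪ ψ.fv
  | .neg φ => φ.fv
  | .know _ φ => φ.fv
  | .assign x t φ => (φ.fv \ {x}) ∪ t.vars

open Classical in
/-- `t.subst x y` replaces the variable `x` by `y` in the term `t`. -/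
noncomputable def Term.subst (x y : S.Var) : Term S → Term S
  | Term.var z => if z = x then Term.var y else Term.var z
  | Term.name a => Term.name a

open Classical in
/-- `φ.subst x y` is `φ[y/x]`: `y` is substituted for all the free occurrences of `x` in `φ`. -/
noncomputable def Formula.subst (x y : S.Var) : Formula S → Formula S
  | .eq t t' => eq (t.subst x y) (t'.subst x y)
  | .pred P ts => pred P (fun k => (ts k).subst x y)
  | .and φ ψ => Formula.and (φ.subst x y) (ψ.subst x y)
  | .neg φ => neg (φ.subst x y)
  | .know i φ => know i (φ.subst x y)
  | .assign z t φ => assign z (t.subst x y) (if z = x then φ else φ.subst x y)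

/-- `φ.Admissible x y`: the substitution `φ[y/x]` is admissible, that is, no occurrence of `y`
that replaces a free occurrence of `x` in `φ` gets bound. -/
def Formula.Admissible (x y : S.Var) : Formula S → Prop
  | .eq _ _ => True
  | .pred _ _ => True
  | .and φ ψ => φ.Admissible x y ∧ ψ.Admissible x y
  | .neg φ => φ.Admissible x y
  | .know _ φ => φ.Admissible x y
  | .assign z _ φ => z = x ∨ x ∉ φ.fv ∨ (z ≠ y ∧ φ.Admissible x y)

/-! ### Semantics -/

/-- First-order Kripke models with a constant domain and non-rigid names and predicates. -/
structure Model (S : Signature.{u}) : Type (u + 1) where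
  World : Type u
  Dom : Type u
  nonempty_world : Nonempty World
  nonempty_dom : Nonempty Dom
  rel : S.Agent → World → World → Prop
  predInterp : (P : S.Pred) → World → Set (Fin (S.arity P) → Dom)
  nameInterp : S.Name → World → Dom

/-- An epistemic model: all the accessibility relations are equivalence relations. -/
def Model.IsEpistemic (M : Model S) : Prop := ∀ i, Equivalence (M.rel i)

/-- The value `σ_w(t)` of a term. -/
def Model.val (M : Model S) (w : M.World) (σ : S.Var → M.Dom) : Term S → M.Dom
  | Term.var x => σ x
  | Term.name a => M.nameInterp a w

open Classical in
/-- Truth of a formula at the pointed model `M, w, σ`. -/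
def Model.Sat (M : Model S) : M.World → (S.Var → M.Dom) → Formula S → Prop
  | w, σ, .eq t t' => M.val w σ t = M.val w σ t'
  | w, σ, .pred P ts => (fun k => M.val w σ (ts k)) ∈ M.predInterp P w
  | w, σ, .and φ ψ => M.Sat w σ φ ∧ M.Sat w σ ψ
  | w, σ, .neg φ => ¬ M.Sat w σ φ
  | w, σ, .know i φ => ∀ v, M.rel i w v → M.Sat v σ φ
  | w, σ, .assign x t φ => M.Sat w (Function.update σ x (M.val w σ t)) φ

/-- `Γ ⊨ φ` over the class `C` of models: `φ` is true at every pointed model based on a member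
of `C` at which all of `Γ` is true. -/
def Entails (C : Set (Model S)) (Γ : Set (Formula S)) (φ : Formula S) : Prop :=
  ∀ M ∈ C, ∀ (w : M.World) (σ : S.Var → M.Dom), (∀ ψ ∈ Γ, M.Sat w σ ψ) → M.Sat w σ φ

/-! ### Proof systems -/

/-- `φ` is an instance of a propositional tautology: it is true under every assignment of truth
values to formulas that respects negation and conjunction. -/
def IsTautology (φ : Formula S) : Prop :=
  ∀ v : Formula S → Prop, (∀ ψ, v (neg ψ) ↔ ¬ v ψ) →
    (∀ ψ χ, v (Formula.and ψ χ) ↔ (v ψ ∧ v χ)) → v φ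

/-- The schemata of the system SBELAS. -/
inductive SBELAS (S : Signature.{u}) : Set (Formula S)
  | taut (φ : Formula S) (h : IsTautology φ) : SBELAS S φ
  | distK (i : S.Agent) (φ ψ : Formula S) :
      SBELAS S (imp (know i (imp φ ψ)) (imp (know i φ) (know i ψ)))
  | id (t : Term S) : SBELAS S (eq t t)
  | sym (t t' : Term S) : SBELAS S (iff (eq t t') (eq t' t))
  | trans (t t' t'' : Term S) : SBELAS S (imp (Formula.and (eq t t') (eq t' t'')) (eq t t''))
  | subAs (t t' : Term S) (x : S.Var) (φ : Formula S) :
      SBELAS S (imp (eq t t') (iff (assign x t φ) (assign x t' φ)))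
  | subP (P : S.Pred) (ts ts' : Fin (S.arity P) → Term S) :
      SBELAS S (imp (conj (List.ofFn fun k => eq (ts k) (ts' k))) (iff (pred P ts) (pred P ts')))
  | rigidP (x y : S.Var) (i : S.Agent) :
      SBELAS S (imp (eq (Term.var x) (Term.var y)) (know i (eq (Term.var x) (Term.var y))))
  | rigidN (x y : S.Var) (i : S.Agent) :
      SBELAS S (imp (neg (eq (Term.var x) (Term.var y)))
        (know i (neg (eq (Term.var x) (Term.var y)))))
  | kAs (x : S.Var) (t : Term S) (φ ψ : Formula S) :
      SBELAS S (imp (assign x t (imp φ ψ)) (imp (assign x t φ) (assign x t ψ)))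
  | detAs (x : S.Var) (t : Term S) (φ : Formula S) :
      SBELAS S (imp (dualAssign x t φ) (assign x t φ))
  | dAs (x : S.Var) (t : Term S) : SBELAS S (dualAssign x t top)
  | efAs (x : S.Var) (t : Term S) : SBELAS S (assign x t (eq (Term.var x) t))
  | sub2As (x y : S.Var) (φ : Formula S) (h : φ.Admissible x y) :
      SBELAS S (imp (φ.subst x y) (assign x (Term.var y) φ))

/-- The schemata of the system SBELAS5: those of SBELAS and `T`, `4`, `5` for every `K_i`. -/
inductive SBELAS5 (S : Signature.{u}) : Set (Formula S)
  | base (φ : Formula S) (h : SBELAS S φ) : SBELAS5 S φ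
  | t (i : S.Agent) (φ : Formula S) : SBELAS5 S (imp (know i φ) φ)
  | four (i : S.Agent) (φ : Formula S) : SBELAS5 S (imp (know i φ) (know i (know i φ)))
  | five (i : S.Agent) (φ : Formula S) :
      SBELAS5 S (imp (neg (know i φ)) (know i (neg (know i φ))))

/-- Theorems of the system with the set `Ax` of schema instances and the rules `MP`, `NECK`
and `NECAS`. -/
inductive Provable (Ax : Set (Formula S)) : Formula S → Prop
  | ax (φ : Formula S) (h : φ ∈ Ax) : Provable Ax φ
  | mp (φ ψ : Formula S) (h₁ : Provable Ax φ) (h₂ : Provable Ax (imp φ ψ)) : Provable Ax ψ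
  | necK (i : S.Agent) (φ : Formula S) (h : Provable Ax φ) : Provable Ax (know i φ)
  | necAs (x : S.Var) (t : Term S) (φ ψ : Formula S) (hx : x ∉ φ.fv)
      (h : Provable Ax (imp φ ψ)) : Provable Ax (imp φ (assign x t ψ))

/-- `Γ ⊢ φ`: some finite conjunction of members of `Γ` provably implies `φ`. -/
def Derives (Ax : Set (Formula S)) (Γ : Set (Formula S)) (φ : Formula S) : Prop :=
  ∃ L : List (Formula S), (∀ ψ ∈ L, ψ ∈ Γ) ∧ Provable Ax (imp (conj L) φ)

/-- Strong completeness over the class `C` of models: `Γ ⊨ φ` over `C` implies `Γ ⊢ φ`, for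
arbitrary (possibly infinite) sets `Γ`. -/
def StronglyComplete (Ax : Set (Formula S)) (C : Set (Model S)) : Prop :=
  ∀ (Γ : Set (Formula S)) (φ : Formula S), Entails C Γ φ → Derives Ax Γ φ

end BELAS

/-!
The proof reduces strong completeness to the satisfiability of single irrefutable formulas, and
builds canonical models for these.

**Reduction.** Both classes of models are closed under ultraproducts, and Łoś's theorem holds
(`Model.ultraproduct_sat`). Hence the consequence relations are compact, and it suffices that each
irrefutable formula `φ` is satisfiable in the class (`stronglyComplete_of_satisfiable`). The gain
is that only a finite vocabulary `V`, that of `φ`, matters: infinitely many variables of the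
signature are left as objects, and only finitely many names require a value.

**Truth lemma.** Variables outside `V` are never bound in formulas over `V`, so they can be put for
free variables without capture (`Formula.inst`), and the substitution axiom turns an assignment
`[x := d]` of such a variable into a substitution (`MCS.assign_inst_iff`). A `CanonicalFrame` is a
system of maximal consistent sets with sets of "active" variables of this kind that are pairwise
unequal and contain a witness `d` with `d ≈ t` for each term `t` of `V`. Membership of instances
in its worlds is truth in the model whose constant domain consists of all variables
(`CanonicalFrame.sat_iff`). There are no quantifiers, so objects that are not active at a world
are invisible there, and the active sets may grow along accessibility.

**All Kripke models.** In `growingFrame`, a successor of a world with finitely many active variables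
may have some more. Witnesses are fresh variables, which are harmless by `Provable.neg_of_neg_and_eq`:
from `d ≈ t → ¬ ψ` one gets `[d := t] ¬ ψ`, hence `¬ ψ`.

**Epistemic models.** Symmetry of accessibility forces the active set to be constant, so witnesses
for the names at all the worlds reachable from the root have to be present at the root. This is the
notion `Saturated`, stated for formulas `Formula.path` that describe finite paths. In S5 a fresh
witness at the end of a path is harmless as well, since `⟨i⟩` is left adjoint to `K_i`
(`SBELAS5.imp_neg_path`). A Henkin construction over a countable vocabulary (`exists_saturated`)
yields a saturated root, and, inside a saturated set, saturated successors
(`Saturated.exists_successor`).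
-/

namespace BELAS

open Formula

variable {S : Signature.{u}} {Ax : Set (Formula S)}

/-! ### Propositional reasoning -/

theorem Provable.of_taut (hAx : SBELAS S ⊆ Ax) {φ : Formula S} (h : IsTautology φ) :
    Provable Ax φ :=
  .ax _ (hAx (.taut _ h))

theorem Provable.taut_mp (hAx : SBELAS S ⊆ Ax) {φ ψ : Formula S} (h₁ : Provable Ax φ)
    (h : IsTautology (imp φ ψ)) : Provable Ax ψ :=
  .mp _ _ h₁ (.of_taut hAx h)

theorem Provable.taut_mp₂ (hAx : SBELAS S ⊆ Ax) {φ₁ φ₂ ψ : Formula S} (h₁ : Provable Ax φ₁)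
    (h₂ : Provable Ax φ₂) (h : IsTautology (imp φ₁ (imp φ₂ ψ))) : Provable Ax ψ :=
  .mp _ _ h₂ (h₁.taut_mp hAx h)

theorem Provable.taut_mp₃ (hAx : SBELAS S ⊆ Ax) {φ₁ φ₂ φ₃ ψ : Formula S}
    (h₁ : Provable Ax φ₁) (h₂ : Provable Ax φ₂) (h₃ : Provable Ax φ₃)
    (h : IsTautology (imp φ₁ (imp φ₂ (imp φ₃ ψ)))) : Provable Ax ψ :=
  .mp _ _ h₃ (h₁.taut_mp₂ hAx h₂ h)

theorem valuation_conj {v : Formula S → Prop} (hn : ∀ ψ, v (neg ψ) ↔ ¬ v ψ)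
    (ha : ∀ ψ χ, v (Formula.and ψ χ) ↔ (v ψ ∧ v χ)) (L : List (Formula S)) :
    v (conj L) ↔ ∀ ψ ∈ L, v ψ := by
  induction L with
  | nil => simp [conj, top, imp, hn, ha]
  | cons φ L ih => simp [conj, ha, ih]

/-! ### Maximal consistent sets -/

/-- A set of formulas is consistent if no finite conjunction of its members is refutable. -/
def Consistent (Ax : Set (Formula S)) (T : Set (Formula S)) : Prop :=
  ∀ L : List (Formula S), (∀ ψ ∈ L, ψ ∈ T) → ¬ Provable Ax (neg (conj L))

/-- Maximal consistent sets, presented as the consistent sets that decide every formula. -/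
structure MCS (Ax : Set (Formula S)) (w : Set (Formula S)) : Prop where
  consistent : Consistent Ax w
  complete : ∀ φ, φ ∈ w ∨ neg φ ∈ w

theorem Consistent.mono {T T' : Set (Formula S)} (h : Consistent Ax T') (hT : T ⊆ T') :
    Consistent Ax T :=
  fun L hL => h L fun ψ hψ => hT (hL ψ hψ)

theorem consistent_singleton (hAx : SBELAS S ⊆ Ax) {φ : Formula S} :
    Consistent Ax {φ} ↔ ¬ Provable Ax (neg φ) := by
  constructor
  · intro h hp
    refine h [φ] (by simp) (hp.taut_mp hAx ?_)
    intro v hn ha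
    simp only [imp, hn, ha, valuation_conj hn ha]
    simp
  · intro h L hL hp
    refine h (hp.taut_mp hAx ?_)
    intro v hn ha
    simp only [imp, hn, ha, valuation_conj hn ha]
    simp only [not_forall, not_and, not_not]
    rintro ⟨ψ, hψ, hv⟩
    rwa [← hL ψ hψ]

theorem Consistent.insert_or (hAx : SBELAS S ⊆ Ax) {T : Set (Formula S)}
    (h : Consistent Ax T) (φ : Formula S) :
    Consistent Ax (insert φ T) ∨ Consistent Ax (insert (neg φ) T) := by
  classical
  by_contra! hcon
  obtain ⟨h₁, h₂⟩ := hcon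
  simp only [Consistent, not_forall, not_not] at h₁ h₂
  obtain ⟨L₁, hL₁, hp₁⟩ := h₁
  obtain ⟨L₂, hL₂, hp₂⟩ := h₂
  refine h (L₁.filter (· ≠ φ) ++ L₂.filter (· ≠ neg φ)) ?_ (hp₁.taut_mp₂ hAx hp₂ ?_)
  · intro ψ hψ
    simp only [List.mem_append, List.mem_filter, decide_eq_true_eq] at hψ
    rcases hψ with ⟨hm, hne⟩ | ⟨hm, hne⟩
    · exact (hL₁ ψ hm).resolve_left hne
    · exact (hL₂ ψ hm).resolve_left hne
  · intro v hn ha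
    simp only [imp, hn, ha, valuation_conj hn ha]
    simp only [List.mem_append, List.mem_filter, decide_eq_true_eq]
    rintro ⟨a₁, b⟩
    apply b
    rintro ⟨a₂, b⟩
    apply b
    intro hall
    by_cases hv : v φ
    · refine a₁ fun ψ hψ => ?_
      by_cases e : ψ = φ
      · exact e ▸ hv
      · exact hall ψ (.inl ⟨hψ, e⟩)
    · refine a₂ fun ψ hψ => ?_
      by_cases e : ψ = neg φ
      · rw [e, hn]; exact hv
      · exact hall ψ (.inr ⟨hψ, e⟩)

/-- Lindenbaum's lemma. -/
theorem Consistent.exists_mcs (hAx : SBELAS S ⊆ Ax) {T : Set (Formula S)}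
    (h : Consistent Ax T) : ∃ w, T ⊆ w ∧ MCS Ax w := by
  have hfc : Order.IsOfFiniteCharacter {T | Consistent Ax T} := by
    intro T
    refine ⟨fun h y hy _ => Consistent.mono h hy, fun h L hL => ?_⟩
    exact h {ψ | ψ ∈ L} hL L.finite_toSet L fun _ hψ => hψ
  obtain ⟨w, hTw, hw⟩ := hfc.exists_maximal h
  refine ⟨w, hTw, hw.prop, fun φ => ?_⟩
  rcases Consistent.insert_or hAx hw.prop φ with h | h
  · exact .inl (hw.le_of_ge h (Set.subset_insert _ _) (Set.mem_insert _ _))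
  · exact .inr (hw.le_of_ge h (Set.subset_insert _ _) (Set.mem_insert _ _))

namespace MCS

variable {w : Set (Formula S)}

theorem mem_of_list (hw : MCS Ax w) (hAx : SBELAS S ⊆ Ax) {L : List (Formula S)}
    (hL : ∀ ψ ∈ L, ψ ∈ w) {φ : Formula S} (h : Provable Ax (imp (conj L) φ)) : φ ∈ w := by
  refine (hw.complete φ).resolve_right fun hφ => ?_
  refine hw.consistent (neg φ :: L) ?_ (h.taut_mp hAx ?_)
  · simpa using ⟨hφ, hL⟩
  · intro v hn ha
    simp only [imp, conj, hn, ha]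
    tauto

theorem mem_of_provable (hw : MCS Ax w) (hAx : SBELAS S ⊆ Ax) {φ : Formula S}
    (h : Provable Ax φ) : φ ∈ w := by
  refine hw.mem_of_list hAx (L := []) (by simp) (h.taut_mp hAx ?_)
  intro v hn ha
  simp only [imp, hn, ha]
  tauto

theorem mem_of_imp (hw : MCS Ax w) (hAx : SBELAS S ⊆ Ax) {φ ψ : Formula S}
    (h : Provable Ax (imp φ ψ)) (hφ : φ ∈ w) : ψ ∈ w := by
  refine hw.mem_of_list hAx (L := [φ]) (by simpa) (h.taut_mp hAx ?_)
  intro v hn ha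
  simp only [imp, conj, hn, ha]
  tauto

theorem mem_neg (hw : MCS Ax w) (hAx : SBELAS S ⊆ Ax) {φ : Formula S} :
    neg φ ∈ w ↔ φ ∉ w := by
  refine ⟨fun h h' => ?_, (hw.complete φ).resolve_left⟩
  refine hw.consistent [φ, neg φ] (by simp [h, h']) (.of_taut hAx ?_)
  intro v hn ha
  simp only [conj, hn, ha]
  tauto

theorem mem_and (hw : MCS Ax w) (hAx : SBELAS S ⊆ Ax) {φ ψ : Formula S} :
    Formula.and φ ψ ∈ w ↔ φ ∈ w ∧ ψ ∈ w := by
  refine ⟨fun h => ⟨hw.mem_of_imp hAx (.of_taut hAx ?_) h,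
    hw.mem_of_imp hAx (.of_taut hAx ?_) h⟩, fun h => ?_⟩
  · intro v hn ha
    simp only [imp, hn, ha]
    tauto
  · intro v hn ha
    simp only [imp, hn, ha]
    tauto
  · refine hw.mem_of_list hAx (L := [φ, ψ]) (by simpa using h) (.of_taut hAx ?_)
    intro v hn ha
    simp only [imp, conj, hn, ha]
    tauto

theorem mem_imp (hw : MCS Ax w) (hAx : SBELAS S ⊆ Ax) {φ ψ : Formula S} :
    imp φ ψ ∈ w ↔ (φ ∈ w → ψ ∈ w) := by
  simp only [imp, hw.mem_neg hAx, hw.mem_and hAx]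
  tauto

theorem mem_iff (hw : MCS Ax w) (hAx : SBELAS S ⊆ Ax) {φ ψ : Formula S} :
    iff φ ψ ∈ w ↔ (φ ∈ w ↔ ψ ∈ w) := by
  simp only [Formula.iff, hw.mem_imp hAx, hw.mem_and hAx]
  tauto

theorem mem_conj (hw : MCS Ax w) (hAx : SBELAS S ⊆ Ax) {L : List (Formula S)} :
    conj L ∈ w ↔ ∀ ψ ∈ L, ψ ∈ w :=
  valuation_conj (fun _ => hw.mem_neg hAx) (fun _ _ => hw.mem_and hAx) L

theorem mem_ax (hw : MCS Ax w) (hAx : SBELAS S ⊆ Ax) {φ : Formula S} (h : SBELAS S φ) :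
    φ ∈ w :=
  hw.mem_of_provable hAx (.ax _ (hAx h))

theorem eq_refl (hw : MCS Ax w) (hAx : SBELAS S ⊆ Ax) (t : Term S) : eq t t ∈ w :=
  hw.mem_ax hAx (.id t)

theorem eq_symm (hw : MCS Ax w) (hAx : SBELAS S ⊆ Ax) {t t' : Term S} (h : eq t t' ∈ w) :
    eq t' t ∈ w :=
  ((hw.mem_iff hAx).1 (hw.mem_ax hAx (.sym t t'))).1 h

theorem eq_trans (hw : MCS Ax w) (hAx : SBELAS S ⊆ Ax) {t t' t'' : Term S}
    (h : eq t t' ∈ w) (h' : eq t' t'' ∈ w) : eq t t'' ∈ w :=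
  (hw.mem_imp hAx).1 (hw.mem_ax hAx (.trans t t' t'')) ((hw.mem_and hAx).2 ⟨h, h'⟩)

theorem assign_congr (hw : MCS Ax w) (hAx : SBELAS S ⊆ Ax) {t t' : Term S}
    (h : eq t t' ∈ w) (x : S.Var) (φ : Formula S) : assign x t φ ∈ w ↔ assign x t' φ ∈ w :=
  (hw.mem_iff hAx).1 ((hw.mem_imp hAx).1 (hw.mem_ax hAx (.subAs t t' x φ)) h)

theorem pred_congr (hw : MCS Ax w) (hAx : SBELAS S ⊆ Ax) {P : S.Pred}
    {ts ts' : Fin (S.arity P) → Term S} (h : ∀ k, eq (ts k) (ts' k) ∈ w) :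
    pred P ts ∈ w ↔ pred P ts' ∈ w := by
  refine (hw.mem_iff hAx).1 ((hw.mem_imp hAx).1 (hw.mem_ax hAx (.subP P ts ts')) ?_)
  rw [hw.mem_conj hAx]
  simp only [List.mem_ofFn]
  rintro _ ⟨k, rfl⟩
  exact h k

end MCS

/-! ### The modalities -/

theorem Term.finite_vars (t : Term S) : t.vars.Finite := by
  cases t <;> simp [Term.vars]

theorem Formula.finite_fv (φ : Formula S) : φ.fv.Finite := by
  induction φ with
  | eq t t' => exact t.finite_vars.union t'.finite_vars
  | pred P ts => exact Set.finite_iUnion fun k => (ts k).finite_vars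
  | and φ ψ h₁ h₂ => exact h₁.union h₂
  | neg φ h => exact h
  | know i φ h => exact h
  | assign x t φ h => exact h.sdiff.union t.finite_vars

theorem Provable.know_mono (hAx : SBELAS S ⊆ Ax) (i : S.Agent) {φ ψ : Formula S}
    (h : Provable Ax (imp φ ψ)) : Provable Ax (imp (know i φ) (know i ψ)) :=
  .mp _ _ (.necK i _ h) (.ax _ (hAx (.distK i φ ψ)))

theorem Provable.know_and (hAx : SBELAS S ⊆ Ax) (i : S.Agent) (φ ψ : Formula S) :
    Provable Ax (imp (Formula.and (know i φ) (know i ψ)) (know i (Formula.and φ ψ))) := by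
  have h : Provable Ax (imp φ (imp ψ (Formula.and φ ψ))) := by
    refine .of_taut hAx fun v hn ha => ?_
    simp only [imp, hn, ha]
    tauto
  refine (know_mono hAx i h).taut_mp₂ hAx (.ax _ (hAx (.distK i ψ (Formula.and φ ψ)))) ?_
  intro v hn ha
  simp only [imp, hn, ha]
  tauto

theorem Provable.know_conj (hAx : SBELAS S ⊆ Ax) (i : S.Agent) (L : List (Formula S)) :
    Provable Ax (imp (conj (L.map (know i))) (know i (conj L))) := by
  induction L with
  | nil =>
    have h : Provable Ax (top : Formula S) := by
      refine .of_taut hAx fun v hn ha => ?_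
      simp only [top, imp, hn, ha]
      tauto
    refine (Provable.necK i _ h).taut_mp hAx fun v hn ha => ?_
    simp only [imp, conj, hn, ha]
    tauto
  | cons φ L ih =>
    refine ih.taut_mp₂ hAx (know_and hAx i φ (conj L)) fun v hn ha => ?_
    simp only [imp, conj, List.map_cons, hn, ha]
    tauto

/-- Necessitation for assignments. The rule of the system needs a premise in which `x` is not
free; the reflexivity axiom of another variable serves as such a premise. -/
theorem Provable.nec_assign (hAx : SBELAS S ⊆ Ax) (x : S.Var) (t : Term S) {φ : Formula S}
    (h : Provable Ax φ) : Provable Ax (assign x t φ) := by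
  obtain ⟨y, hy⟩ := exists_ne x
  refine .mp _ _ (.ax _ (hAx (.id (.var y)))) (.necAs x t _ φ ?_ (h.taut_mp hAx ?_))
  · simpa [Formula.fv, Term.vars] using hy.symm
  · intro v hn ha
    simp only [imp, hn, ha]
    tauto

theorem Provable.assign_mono (hAx : SBELAS S ⊆ Ax) (x : S.Var) (t : Term S) {φ ψ : Formula S}
    (h : Provable Ax (imp φ ψ)) : Provable Ax (imp (assign x t φ) (assign x t ψ)) :=
  .mp _ _ (h.nec_assign hAx x t) (.ax _ (hAx (.kAs x t φ ψ)))

/-- Assignments are total: `[x := t] φ` and `[x := t] ¬ φ` exclude each other. -/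
theorem Provable.assign_neg (hAx : SBELAS S ⊆ Ax) (x : S.Var) (t : Term S) (φ : Formula S) :
    Provable Ax (imp (assign x t (neg φ)) (neg (assign x t φ))) := by
  have h : Provable Ax (imp φ (imp (neg φ) (neg top))) := by
    refine .of_taut hAx fun v hn ha => ?_
    simp only [imp, hn, ha]
    tauto
  refine (h.assign_mono hAx x t).taut_mp₃ hAx (.ax _ (hAx (.kAs x t (neg φ) (neg top))))
    (.ax _ (hAx (.dAs x t))) fun v hn ha => ?_
  simp only [imp, dualAssign, hn, ha]
  tauto

theorem MCS.assign_iff_subst {w : Set (Formula S)} (hw : MCS Ax w) (hAx : SBELAS S ⊆ Ax)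
    {x y : S.Var} {φ : Formula S} (h : φ.Admissible x y) :
    assign x (.var y) φ ∈ w ↔ φ.subst x y ∈ w := by
  refine ⟨fun h₁ => ?_, (hw.mem_imp hAx).1 (hw.mem_ax hAx (.sub2As x y φ h))⟩
  by_contra h₂
  -- The converse direction is the axiom for `¬ φ`, as assignments commute with negation.
  have h₃ : assign x (.var y) (neg φ) ∈ w :=
    (hw.mem_imp hAx).1 (hw.mem_ax hAx (.sub2As x y (neg φ) h)) ((hw.mem_neg hAx).2 h₂)
  exact (hw.mem_neg hAx).1 (hw.mem_of_imp hAx (.assign_neg hAx x _ φ) h₃) h₁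

/-- A fresh variable may be taken to denote the value of any term: a formula refuted by `d ≈ t`
with `d` not free in it is refutable, by generalizing over `[d := t]`. -/
theorem Provable.neg_of_neg_and_eq (hAx : SBELAS S ⊆ Ax) {ψ : Formula S} {d : S.Var}
    {t : Term S} (hd : d ∉ ψ.fv) (h : Provable Ax (neg (Formula.and ψ (eq (.var d) t)))) :
    Provable Ax (neg ψ) := by
  have h₁ : Provable Ax (imp (eq (.var d) t) (neg ψ)) := by
    refine h.taut_mp hAx fun v hn ha => ?_
    simp only [imp, hn, ha]
    tauto
  have h₂ : Provable Ax (assign d t (neg ψ)) :=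
    .mp _ _ (.ax _ (hAx (.efAs d t))) (h₁.assign_mono hAx d t)
  have h₃ : Provable Ax (imp ψ (assign d t ψ)) := by
    refine .necAs d t ψ ψ hd (.of_taut hAx fun v hn ha => ?_)
    simp only [imp, hn, ha]
    tauto
  refine h₂.taut_mp₃ hAx (.assign_neg hAx d t ψ) h₃ fun v hn ha => ?_
  simp only [imp, hn, ha]
  tauto

/-! ### Ultraproducts and compactness -/

section Ultraproduct

open Filter

variable {ι : Type u} (U : Ultrafilter ι) (M : ι → Model S)

/-- The ultraproduct of a family of models. Only the domain is divided by the ultrafilter: the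
language does not speak about identity of worlds, so families of worlds need no identification. -/
noncomputable def Model.ultraproduct : Model S where
  World := ∀ j, (M j).World
  Dom := (U : Filter ι).Product fun j => (M j).Dom
  nonempty_world := ⟨fun j => (M j).nonempty_world.some⟩
  nonempty_dom := ⟨Quotient.mk _ fun j => (M j).nonempty_dom.some⟩
  rel i w v := ∀ᶠ j in U, (M j).rel i (w j) (v j)
  predInterp P w := {f | ∀ᶠ j in U, (fun k => (f k).out j) ∈ (M j).predInterp P (w j)}
  nameInterp a w := Quotient.mk _ fun j => (M j).nameInterp a (w j)

theorem Model.ultraproduct_val (w : ∀ j, (M j).World) (s : S.Var → ∀ j, (M j).Dom)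
    (t : Term S) :
    (Model.ultraproduct U M).val w (fun x => Quotient.mk _ (s x)) t =
      Quotient.mk _ fun j => (M j).val (w j) (fun x => s x j) t := by
  cases t <;> rfl

/-- Łoś's theorem. -/
theorem Model.ultraproduct_sat (φ : Formula S) :
    ∀ (w : ∀ j, (M j).World) (s : S.Var → ∀ j, (M j).Dom),
      (Model.ultraproduct U M).Sat w (fun x => Quotient.mk _ (s x)) φ ↔
        ∀ᶠ j in U, (M j).Sat (w j) (fun x => s x j) φ := by
  induction φ with
  | eq t t' =>
    intro w s
    simp only [Model.Sat, Model.ultraproduct_val]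
    exact Quotient.eq
  | pred P ts =>
    intro w s
    simp only [Model.Sat, Model.ultraproduct_val]
    have h : ∀ᶠ j in U, ∀ k, (Quotient.mk (productSetoid (U : Filter ι) fun j => (M j).Dom)
        fun j => (M j).val (w j) (fun x => s x j) (ts k)).out j =
          (M j).val (w j) (fun x => s x j) (ts k) :=
      eventually_all.2 fun k => Quotient.mk_out (s := productSetoid (U : Filter ι) _) _
    refine eventually_congr (h.mono fun j hj => ?_)
    simp only [hj]
  | and φ ψ h₁ h₂ =>
    intro w s
    simp only [Model.Sat, h₁, h₂, eventually_and]
  | neg φ h =>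
    intro w s
    simp only [Model.Sat, h, Ultrafilter.eventually_not]
  | know i φ h =>
    intro w s
    simp only [Model.Sat]
    refine ⟨fun hK => ?_, fun hK v hv => (h v s).2 ?_⟩
    · by_contra hn
      rw [← Ultrafilter.eventually_not] at hn
      -- Choose a counterexample to `K_i φ` in every factor that has one.
      have hex : ∀ j, ∃ v, ¬ (∀ v, (M j).rel i (w j) v → (M j).Sat v (fun x => s x j) φ) →
          (M j).rel i (w j) v ∧ ¬ (M j).Sat v (fun x => s x j) φ := by
        intro j
        by_cases hj : ∀ v, (M j).rel i (w j) v → (M j).Sat v (fun x => s x j) φ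
        · exact ⟨w j, fun h => (h hj).elim⟩
        · push Not at hj
          exact ⟨hj.choose, fun _ => hj.choose_spec⟩
      choose v hv using hex
      have h₁ := (h v s).1 (hK v (hn.mono fun j hj => (hv j hj).1))
      obtain ⟨j, hj₁, hj₂⟩ := (h₁.and hn).exists
      exact (hv j hj₂).2 hj₁
    · filter_upwards [hK, hv] with j hj hvj using hj _ hvj
  | assign x t φ h =>
    intro w s
    classical
    simp only [Model.Sat, Model.ultraproduct_val]
    have e₁ : Function.update (fun x => Quotient.mk (productSetoid (U : Filter ι) _) (s x)) x
        (Quotient.mk _ fun j => (M j).val (w j) (fun x => s x j) t) =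
        fun y => Quotient.mk (productSetoid (U : Filter ι) _)
          (Function.update s x (fun j => (M j).val (w j) (fun x => s x j) t) y) := by
      funext y
      by_cases hy : y = x
      · subst hy; simp
      · simp [hy]
    have e₂ : ∀ j, Function.update (fun x => s x j) x ((M j).val (w j) (fun x => s x j) t) =
        fun y => Function.update s x (fun j => (M j).val (w j) (fun x => s x j) t) y j := by
      intro j
      funext y
      by_cases hy : y = x
      · subst hy; simp
      · simp [hy]
    have := h w (Function.update s x fun j => (M j).val (w j) (fun x => s x j) t)
    simp only [← e₂] at this
    rw [← this]
    exact iff_of_eq (congrArg (fun σ => (Model.ultraproduct U M).Sat w σ φ) e₁)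

theorem Model.ultraproduct_isEpistemic (h : ∀ j, (M j).IsEpistemic) :
    (Model.ultraproduct U M).IsEpistemic := fun i =>
  { refl := fun _ => .of_forall fun j => (h j i).refl _
    symm := fun hwv => hwv.mono fun j hj => (h j i).symm hj
    trans := fun h₁ h₂ => by filter_upwards [h₁, h₂] with j h₁ h₂ using (h j i).trans h₁ h₂ }

end Ultraproduct

/-- Strong completeness follows from the satisfiability of all irrefutable formulas if the class
of models is closed under ultraproducts. -/
theorem stronglyComplete_of_satisfiable (hAx : SBELAS S ⊆ Ax) {C : Set (Model S)}
    (hC : ∀ {ι : Type u} (U : Ultrafilter ι) (M : ι → Model S), (∀ j, M j ∈ C) →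
      Model.ultraproduct U M ∈ C)
    (h : ∀ φ, ¬ Provable Ax (neg φ) →
      ∃ M ∈ C, ∃ (w : M.World) (σ : S.Var → M.Dom), M.Sat w σ φ) :
    StronglyComplete Ax C := by
  intro Γ φ hent
  by_contra hder
  have hsat : ∀ s : Finset Γ, ∃ M ∈ C, ∃ (w : M.World) (σ : S.Var → M.Dom),
      (∀ ψ ∈ s, M.Sat w σ ψ) ∧ ¬ M.Sat w σ φ := by
    intro s
    let L : List (Formula S) := s.toList.map (↑)
    obtain ⟨M, hM, w, σ, hσ⟩ := h (Formula.and (conj L) (neg φ)) fun hp => hder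
      ⟨L, by simp +contextual [L], hp.taut_mp hAx fun v hn ha => by
        simp only [imp, hn, ha]
        tauto⟩
    simp only [Model.Sat] at hσ
    refine ⟨M, hM, w, σ, fun ψ hψ => ?_, hσ.2⟩
    refine (valuation_conj (v := M.Sat w σ) (fun _ => ?_) (fun _ _ => ?_) L).1 hσ.1 ψ ?_
    · simp only [Model.Sat]
    · simp only [Model.Sat]
    · simpa [L] using hψ
  choose M hM w σ hs hφ using hsat
  let U : Ultrafilter (Finset Γ) := .of Filter.atTop
  have hΓ := hent _ (hC U M hM) w (fun x => Quotient.mk _ fun s => σ s x) fun ψ hψ => by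
    rw [Model.ultraproduct_sat]
    refine Ultrafilter.of_le Filter.atTop ?_
    filter_upwards [Filter.eventually_ge_atTop {⟨ψ, hψ⟩}] with s hle
    exact hs s ⟨ψ, hψ⟩ (hle (Finset.mem_singleton_self _))
  rw [Model.ultraproduct_sat] at hΓ
  obtain ⟨s, hsφ⟩ := hΓ.exists
  exact hφ s hsφ

/-! ### Finite vocabularies -/

/-- A part of a signature: the terms, agents and predicate symbols that formulas over it may
use. Its variables are those that are terms of the vocabulary. -/
structure Vocabulary (S : Signature.{u}) where
  terms : Set (Term S)
  agents : Set S.Agent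
  preds : Set S.Pred

/-- `φ.Over V`: all the terms, bound variables, agents and predicate symbols that occur in `φ`
belong to `V`. -/
def Formula.Over (V : Vocabulary S) : Formula S → Prop
  | .eq t t' => t ∈ V.terms ∧ t' ∈ V.terms
  | .pred P ts => P ∈ V.preds ∧ ∀ k, ts k ∈ V.terms
  | .and φ ψ => φ.Over V ∧ ψ.Over V
  | .neg φ => φ.Over V
  | .know i φ => i ∈ V.agents ∧ φ.Over V
  | .assign x t φ => Term.var x ∈ V.terms ∧ t ∈ V.terms ∧ φ.Over V

/-- The componentwise union of two vocabularies. -/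
def Vocabulary.union (V V' : Vocabulary S) : Vocabulary S where
  terms := V.terms ∪ V'.terms
  agents := V.agents ∪ V'.agents
  preds := V.preds ∪ V'.preds

theorem Formula.Over.mono {V V' : Vocabulary S} (ht : V.terms ⊆ V'.terms)
    (ha : V.agents ⊆ V'.agents) (hp : V.preds ⊆ V'.preds) {φ : Formula S} (h : φ.Over V) :
    φ.Over V' := by
  induction φ with
  | eq t t' => exact ⟨ht h.1, ht h.2⟩
  | pred P ts => exact ⟨hp h.1, fun k => ht (h.2 k)⟩
  | and φ ψ h₁ h₂ => exact ⟨h₁ h.1, h₂ h.2⟩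
  | neg φ ih => exact ih h
  | know i φ ih => exact ⟨ha h.1, ih h.2⟩
  | assign x t φ ih => exact ⟨ht h.1, ht h.2.1, ih h.2.2⟩

/-- Finiteness of all the components of a vocabulary. -/
structure Vocabulary.IsFinite (V : Vocabulary S) : Prop where
  terms : V.terms.Finite
  agents : V.agents.Finite
  preds : V.preds.Finite

theorem Vocabulary.IsFinite.union {V V' : Vocabulary S} (h : V.IsFinite) (h' : V'.IsFinite) :
    (V.union V').IsFinite :=
  ⟨h.terms.union h'.terms, h.agents.union h'.agents, h.preds.union h'.preds⟩

theorem Formula.Over.union_left {V : Vocabulary S} (V' : Vocabulary S) {φ : Formula S}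
    (h : φ.Over V) : φ.Over (V.union V') :=
  h.mono Set.subset_union_left Set.subset_union_left Set.subset_union_left

theorem Formula.Over.union_right (V : Vocabulary S) {V' : Vocabulary S} {φ : Formula S}
    (h : φ.Over V') : φ.Over (V.union V') :=
  h.mono Set.subset_union_right Set.subset_union_right Set.subset_union_right

theorem Formula.exists_over (φ : Formula S) : ∃ V : Vocabulary S, V.IsFinite ∧ φ.Over V := by
  induction φ with
  | eq t t' => exact ⟨⟨{t, t'}, ∅, ∅⟩, ⟨by simp, by simp, by simp⟩, by simp [Formula.Over]⟩
  | pred P ts =>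
    exact ⟨⟨Set.range ts, ∅, {P}⟩, ⟨Set.finite_range _, by simp, by simp⟩,
      by simp [Formula.Over]⟩
  | and φ ψ h₁ h₂ =>
    obtain ⟨V₁, hV₁, h₁⟩ := h₁
    obtain ⟨V₂, hV₂, h₂⟩ := h₂
    exact ⟨V₁.union V₂, hV₁.union hV₂, h₁.union_left _, h₂.union_right _⟩
  | neg φ h => exact h
  | know i φ h =>
    obtain ⟨V, hV, h⟩ := h
    refine ⟨V.union ⟨∅, {i}, ∅⟩, hV.union ⟨by simp, by simp, by simp⟩, ?_, h.union_left _⟩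
    simp [Vocabulary.union]
  | assign x t φ h =>
    obtain ⟨V, hV, h⟩ := h
    refine ⟨V.union ⟨{.var x, t}, ∅, ∅⟩, hV.union ⟨by simp, by simp, by simp⟩, ?_, ?_,
      h.union_left _⟩ <;> simp [Vocabulary.union]

theorem Formula.Over.var_mem {V : Vocabulary S} {φ : Formula S} (h : φ.Over V) {x : S.Var}
    (hx : x ∈ φ.fv) : Term.var x ∈ V.terms := by
  have ht : ∀ {t : Term S}, t ∈ V.terms → x ∈ t.vars → Term.var x ∈ V.terms := by
    intro t ht hxt
    cases t with
    | var y => rw [Term.vars, Set.mem_singleton_iff] at hxt; exact hxt ▸ ht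
    | name a => exact hxt.elim
  induction φ with
  | eq t t' => exact hx.elim (ht h.1) (ht h.2)
  | pred P ts =>
    obtain ⟨k, hk⟩ := Set.mem_iUnion.1 hx
    exact ht (h.2 k) hk
  | and φ ψ h₁ h₂ => exact hx.elim (h₁ h.1) (h₂ h.2)
  | neg φ ih => exact ih h hx
  | know i φ ih => exact ih h.2 hx
  | assign z t φ ih => exact hx.elim (fun hx => ih h.2.2 hx.1) (ht h.2.1)

/-! ### Instances of formulas -/

/-- The instance of a term under a map of variables. -/
def Term.inst (σ : S.Var → S.Var) : Term S → Term S
  | .var x => .var (σ x)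
  | .name a => .name a

open Classical in
/-- `φ.inst σ` replaces every free occurrence of each variable `x` in `φ` by `σ x`. Bound
variables are not renamed, so the values of `σ` should not be bound in `φ`. -/
noncomputable def Formula.inst : (S.Var → S.Var) → Formula S → Formula S
  | σ, .eq t t' => eq (t.inst σ) (t'.inst σ)
  | σ, .pred P ts => pred P fun k => (ts k).inst σ
  | σ, .and φ ψ => Formula.and (φ.inst σ) (ψ.inst σ)
  | σ, .neg φ => neg (φ.inst σ)
  | σ, .know i φ => know i (φ.inst σ)
  | σ, .assign x t φ => assign x (t.inst σ) (φ.inst (Function.update σ x x))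

theorem Term.inst_congr {σ τ : S.Var → S.Var} {t : Term S} (h : ∀ x ∈ t.vars, σ x = τ x) :
    t.inst σ = t.inst τ := by
  cases t with
  | var x => exact congrArg Term.var (h x rfl)
  | name a => rfl

theorem Formula.inst_congr {φ : Formula S} {σ τ : S.Var → S.Var}
    (h : ∀ x ∈ φ.fv, σ x = τ x) : φ.inst σ = φ.inst τ := by
  induction φ generalizing σ τ with
  | eq t t' =>
    simp only [Formula.inst, Term.inst_congr fun x hx => h x (.inl hx),
      Term.inst_congr fun x hx => h x (.inr hx)]
  | pred P ts =>
    simp only [Formula.inst, Term.inst_congr fun x hx => h x (Set.mem_iUnion.2 ⟨_, hx⟩)]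
  | and φ ψ h₁ h₂ =>
    simp only [Formula.inst, h₁ fun x hx => h x (.inl hx), h₂ fun x hx => h x (.inr hx)]
  | neg φ ih => simp only [Formula.inst, ih h]
  | know i φ ih => simp only [Formula.inst, ih h]
  | assign x t φ ih =>
    simp only [Formula.inst, Term.inst_congr fun x hx => h x (.inr hx)]
    rw [ih]
    intro y hy
    by_cases e : y = x
    · subst e; simp
    · simpa [e] using h y (.inl ⟨hy, e⟩)

theorem Formula.inst_id (φ : Formula S) : φ.inst id = φ := by
  have ht : ∀ t : Term S, t.inst id = t := by rintro (x | a) <;> rfl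
  induction φ with
  | assign x t φ ih =>
    simp only [Formula.inst, ht]
    classical
    rw [show Function.update id x x = (id : S.Var → S.Var) from Function.update_eq_self _ _, ih]
  | _ => simp_all [Formula.inst]

theorem Formula.Over.inst {V V' : Vocabulary S} (ht : V.terms ⊆ V'.terms)
    (ha : V.agents ⊆ V'.agents) (hp : V.preds ⊆ V'.preds) {φ : Formula S} (h : φ.Over V)
    {σ : S.Var → S.Var} (hσ : ∀ x ∈ φ.fv, Term.var (σ x) ∈ V'.terms) :
    (φ.inst σ).Over V' := by
  have hterm : ∀ {t : Term S} {σ : S.Var → S.Var}, t ∈ V.terms →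
      (∀ x ∈ t.vars, Term.var (σ x) ∈ V'.terms) → t.inst σ ∈ V'.terms := by
    rintro (x | a) σ h hσ
    · exact hσ x rfl
    · exact ht h
  induction φ generalizing σ with
  | eq t t' =>
    exact ⟨hterm h.1 fun x hx => hσ x (.inl hx), hterm h.2 fun x hx => hσ x (.inr hx)⟩
  | pred P ts =>
    exact ⟨hp h.1, fun k => hterm (h.2 k) fun x hx => hσ x (Set.mem_iUnion.2 ⟨k, hx⟩)⟩
  | and φ ψ h₁ h₂ =>
    exact ⟨h₁ h.1 fun x hx => hσ x (.inl hx), h₂ h.2 fun x hx => hσ x (.inr hx)⟩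
  | neg φ ih => exact ih h hσ
  | know i φ ih => exact ⟨ha h.1, ih h.2 hσ⟩
  | assign x t φ ih =>
    refine ⟨ht h.1, hterm h.2.1 fun x hx => hσ x (.inr hx), ih h.2.2 fun y hy => ?_⟩
    by_cases e : y = x
    · subst e; simpa using ht h.1
    · simpa [e] using hσ y (.inl ⟨hy, e⟩)

theorem Formula.fv_inst_subset {A : Set S.Var} {φ : Formula S} {σ : S.Var → S.Var}
    (hσ : ∀ x ∈ φ.fv, σ x ∈ A) : (φ.inst σ).fv ⊆ A := by
  have hterm : ∀ {t : Term S} {σ : S.Var → S.Var} {A : Set S.Var}, (∀ x ∈ t.vars, σ x ∈ A) →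
      (t.inst σ).vars ⊆ A := by
    rintro (x | a) σ A hσ
    · simpa [Term.inst, Term.vars] using hσ x rfl
    · exact Set.empty_subset _
  induction φ generalizing σ A with
  | eq t t' =>
    exact Set.union_subset (hterm fun x hx => hσ x (.inl hx)) (hterm fun x hx => hσ x (.inr hx))
  | pred P ts =>
    exact Set.iUnion_subset fun k => hterm fun x hx => hσ x (Set.mem_iUnion.2 ⟨k, hx⟩)
  | and φ ψ h₁ h₂ =>
    exact Set.union_subset (h₁ fun x hx => hσ x (.inl hx)) (h₂ fun x hx => hσ x (.inr hx))
  | neg φ ih => exact ih hσ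
  | know i φ ih => exact ih hσ
  | assign x t φ ih =>
    classical
    refine Set.union_subset ?_ (hterm fun x hx => hσ x (.inr hx))
    have := ih (A := insert x A) (σ := Function.update σ x x) fun y hy => by
      by_cases e : y = x
      · subst e; simp
      · simpa [e] using Or.inr (hσ y (.inl ⟨hy, e⟩))
    simpa [Set.sdiff_subset_iff] using this

theorem Formula.admissible_inst {V : Vocabulary S} {φ : Formula S} (h : φ.Over V) {d : S.Var}
    (hd : Term.var d ∉ V.terms) (x : S.Var) (σ : S.Var → S.Var) :
    (φ.inst σ).Admissible x d := by
  induction φ generalizing σ with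
  | eq t t' => trivial
  | pred P ts => trivial
  | and φ ψ h₁ h₂ => exact ⟨h₁ h.1 σ, h₂ h.2 σ⟩
  | neg φ ih => exact ih h σ
  | know i φ ih => exact ih h.2 σ
  | assign z t φ ih => exact .inr (.inr ⟨fun e => hd (e ▸ h.1), ih h.2.2 _⟩)

theorem Formula.admissible_self (φ : Formula S) (x : S.Var) : φ.Admissible x x := by
  induction φ with
  | eq t t' => trivial
  | pred P ts => trivial
  | and φ ψ h₁ h₂ => exact ⟨h₁, h₂⟩
  | neg φ ih => exact ih
  | know i φ ih => exact ih
  | assign z t φ ih =>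
    by_cases e : z = x
    · exact .inl e
    · exact .inr (.inr ⟨e, ih⟩)

theorem Formula.subst_self (φ : Formula S) (x : S.Var) : φ.subst x x = φ := by
  have ht : ∀ t : Term S, t.subst x x = t := by
    rintro (y | a)
    · by_cases e : y = x <;> simp [Term.subst, e]
    · rfl
  induction φ with
  | assign z t φ ih => simp [Formula.subst, ht, ih]
  | _ => simp_all [Formula.subst]

theorem Formula.subst_inst [DecidableEq S.Var] {x d : S.Var} {φ : Formula S}
    {σ : S.Var → S.Var} (hx : σ x = x) (hσ : ∀ y ∈ φ.fv, y ≠ x → σ y ≠ x) :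
    (φ.inst σ).subst x d = φ.inst (Function.update σ x d) := by
  have hterm : ∀ {t : Term S} {σ : S.Var → S.Var}, σ x = x → (∀ y ∈ t.vars, y ≠ x → σ y ≠ x) →
      (t.inst σ).subst x d = t.inst (Function.update σ x d) := by
    rintro (y | a) σ hx hσ
    · by_cases e : y = x
      · subst e; simp [Term.inst, Term.subst, hx]
      · simp [Term.inst, Term.subst, e, hσ y rfl e]
    · rfl
  induction φ generalizing σ with
  | eq t t' =>
    simp only [Formula.inst, Formula.subst]
    rw [hterm hx fun y hy => hσ y (.inl hy), hterm hx fun y hy => hσ y (.inr hy)]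
  | pred P ts =>
    simp only [Formula.inst, Formula.subst]
    congr 1
    exact funext fun k => hterm hx fun y hy => hσ y (Set.mem_iUnion.2 ⟨k, hy⟩)
  | and φ ψ h₁ h₂ =>
    simp only [Formula.inst, Formula.subst]
    rw [h₁ hx fun y hy => hσ y (.inl hy), h₂ hx fun y hy => hσ y (.inr hy)]
  | neg φ ih => simp only [Formula.inst, Formula.subst, ih hx hσ]
  | know i φ ih => simp only [Formula.inst, Formula.subst, ih hx hσ]
  | assign z t φ ih =>
    simp only [Formula.inst, Formula.subst]
    rw [hterm hx fun y hy => hσ y (.inr hy)]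
    congr 1
    by_cases e : z = x
    · subst e
      rw [if_pos rfl]
      congr 1
      funext y
      by_cases hy : y = z <;> simp [hy]
    · rw [if_neg e, ih]
      · congr 1
        funext y
        by_cases hy : y = z
        · subst hy; simp [e]
        · by_cases hy' : y = x
          · subst hy'; simp [hy]
          · simp [hy, hy']
      · simpa [Ne.symm e] using hx
      · intro y hy hyx
        by_cases hyz : y = z
        · subst hyz; simpa using e
        · simpa [hyz] using hσ y (.inl ⟨hy, hyz⟩) hyx

/-- Assigning to `x` a variable `d` that is never bound has the effect of substitution. -/
theorem MCS.assign_inst_iff {w : Set (Formula S)} (hw : MCS Ax w) (hAx : SBELAS S ⊆ Ax)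
    [DecidableEq S.Var] {V : Vocabulary S} {φ : Formula S} (h : φ.Over V) {x d : S.Var}
    (hd : Term.var d ∉ V.terms) {σ : S.Var → S.Var} (hx : σ x = x)
    (hσ : ∀ y ∈ φ.fv, y ≠ x → σ y ≠ x) :
    assign x (.var d) (φ.inst σ) ∈ w ↔ φ.inst (Function.update σ x d) ∈ w := by
  rw [hw.assign_iff_subst hAx (admissible_inst h hd x σ), subst_inst hx hσ]

/-- Free variables may be replaced by variables that are never bound and denote the same
objects. -/
theorem MCS.inst_mem {w : Set (Formula S)} (hw : MCS Ax w) (hAx : SBELAS S ⊆ Ax)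
    {V : Vocabulary S} {φ : Formula S} (h : φ.Over V) {σ : S.Var → S.Var}
    (hσ : ∀ x ∈ φ.fv, Term.var (σ x) ∉ V.terms ∧ eq (.var (σ x)) (.var x) ∈ w) (hφ : φ ∈ w) :
    φ.inst σ ∈ w := by
  classical
  have key : ∀ s : Finset S.Var, ↑s ⊆ φ.fv → φ.inst (fun x => if x ∈ s then σ x else x) ∈ w := by
    intro s
    induction s using Finset.induction_on with
    | empty =>
      intro _
      have : φ.inst id ∈ w := by rwa [inst_id]
      simpa only [Finset.notMem_empty, if_false] using! this
    | insert x s hxs ih =>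
      intro hs
      have hx : x ∈ φ.fv := hs (by simp)
      set τ : S.Var → S.Var := fun x => if x ∈ s then σ x else x with hτ
      have h₁ : φ.inst τ ∈ w := ih fun y hy => hs (by simp [Finset.mem_coe.1 hy])
      -- `[x := x]` changes nothing, and `x` and `σ x` are equal at `w`.
      have h₂ : assign x (.var x) (φ.inst τ) ∈ w := by
        rwa [hw.assign_iff_subst hAx (admissible_self _ x), subst_self]
      have h₃ : assign x (.var (σ x)) (φ.inst τ) ∈ w :=
        (hw.assign_congr hAx (hσ x hx).2 _ _).2 h₂
      rw [hw.assign_inst_iff hAx h (hσ x hx).1 (by simp [hτ, hxs])] at h₃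
      · convert h₃ using 2
        funext y
        by_cases e : y = x
        · subst e; simp
        · simp [hτ, e]
      · intro y hy hyx e
        by_cases hys : y ∈ s
        · simp only [hτ, hys, if_true] at e
          exact (hσ y hy).1 (e ▸ h.var_mem hx)
        · simp only [hτ, hys, if_false] at e
          exact hyx e
  have := key φ.finite_fv.toFinset (by simp)
  rwa [Formula.inst_congr (τ := σ)] at this
  intro x hx
  simp [hx]

/-! ### Canonical frames and the truth lemma -/

/-- A system of maximal consistent sets from which a model of the formulas over `V` can be read
off. Each world comes with a set of active variables, which never occur in formulas over `V`
themselves; they serve as the objects that exist so far. The truth lemma concerns instances of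
formulas over `V` under maps into the active variables. -/
structure CanonicalFrame (Ax : Set (Formula S)) (V : Vocabulary S) where
  World : Type u
  th : World → Set (Formula S)
  active : World → Set S.Var
  rel : S.Agent → World → World → Prop
  mcs : ∀ w, MCS Ax (th w)
  fresh : ∀ w, ∀ d ∈ active w, Term.var d ∉ V.terms
  distinct : ∀ w, ∀ d ∈ active w, ∀ d' ∈ active w, eq (.var d) (.var d') ∈ th w → d = d'
  witness : ∀ w, ∀ t ∈ V.terms, ∃ d ∈ active w, eq (.var d) t ∈ th w
  active_mono : ∀ {i w v}, rel i w v → active w ⊆ active v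
  know_mem : ∀ {i w v}, i ∈ V.agents → rel i w v → ∀ {φ : Formula S} {σ : S.Var → S.Var},
    φ.Over V → (∀ x ∈ φ.fv, σ x ∈ active w) → know i (φ.inst σ) ∈ th w → φ.inst σ ∈ th v
  exists_rel : ∀ {i w}, i ∈ V.agents → ∀ {φ : Formula S} {σ : S.Var → S.Var},
    φ.Over V → (∀ x ∈ φ.fv, σ x ∈ active w) → know i (φ.inst σ) ∉ th w →
      ∃ v, rel i w v ∧ φ.inst σ ∉ th v

namespace CanonicalFrame

variable {V : Vocabulary S} (F : CanonicalFrame Ax V)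

/-- The model of a canonical frame. All variables form its constant domain, although only the
active ones matter at a given world. -/
noncomputable def toModel [Nonempty F.World] : Model S where
  World := F.World
  Dom := S.Var
  nonempty_world := inferInstance
  nonempty_dom := inferInstance
  rel := F.rel
  predInterp P w := {f | pred P (fun k => .var (f k)) ∈ F.th w}
  nameInterp a w := Classical.epsilon fun d => d ∈ F.active w ∧ eq (.var d) (.name a) ∈ F.th w

variable [Nonempty F.World]

theorem val_spec (hAx : SBELAS S ⊆ Ax) (w : F.World) {σ : S.Var → S.Var} {t : Term S}
    (ht : t ∈ V.terms) (hσ : ∀ x ∈ t.vars, σ x ∈ F.active w) :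
    F.toModel.val w σ t ∈ F.active w ∧
      eq (.var (F.toModel.val w σ t)) (t.inst σ) ∈ F.th w := by
  cases t with
  | var x => exact ⟨hσ x rfl, (F.mcs w).eq_refl hAx _⟩
  | name a => exact Classical.epsilon_spec (F.witness w _ ht)

theorem sat_iff (hAx : SBELAS S ⊆ Ax) {φ : Formula S} (hφ : φ.Over V) (w : F.World)
    {σ : S.Var → S.Var} (hσ : ∀ x ∈ φ.fv, σ x ∈ F.active w) :
    F.toModel.Sat w σ φ ↔ φ.inst σ ∈ F.th w := by
  induction φ generalizing w σ with
  | eq t t' =>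
    have hw := F.mcs w
    obtain ⟨h₁, h₂⟩ := F.val_spec hAx w hφ.1 fun x hx => hσ x (.inl hx)
    obtain ⟨h₁', h₂'⟩ := F.val_spec hAx w hφ.2 fun x hx => hσ x (.inr hx)
    simp only [Model.Sat, Formula.inst]
    constructor
    · intro h
      rw [← h] at h₂'
      exact hw.eq_trans hAx (hw.eq_symm hAx h₂) h₂'
    · intro h
      exact F.distinct w _ h₁ _ h₁' (hw.eq_trans hAx h₂ (hw.eq_trans hAx h (hw.eq_symm hAx h₂')))
  | pred P ts =>
    exact (F.mcs w).pred_congr hAx fun k =>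
      (F.val_spec hAx w (hφ.2 k) fun x hx => hσ x (Set.mem_iUnion.2 ⟨k, hx⟩)).2
  | and φ ψ h₁ h₂ =>
    simp only [Model.Sat, Formula.inst, (F.mcs w).mem_and hAx,
      h₁ hφ.1 w fun x hx => hσ x (.inl hx), h₂ hφ.2 w fun x hx => hσ x (.inr hx)]
  | neg φ ih => simp only [Model.Sat, Formula.inst, (F.mcs w).mem_neg hAx, ih hφ w hσ]
  | know i φ ih =>
    simp only [Model.Sat, Formula.inst]
    constructor
    · intro h
      by_contra hn
      obtain ⟨v, hwv, hv⟩ := F.exists_rel hφ.1 hφ.2 hσ hn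
      exact hv ((ih hφ.2 v fun x hx => F.active_mono hwv (hσ x hx)).1 (h v hwv))
    · intro h v hwv
      exact (ih hφ.2 v fun x hx => F.active_mono hwv (hσ x hx)).2
        (F.know_mem hφ.1 hwv hφ.2 hσ h)
  | assign x t φ ih =>
    classical
    obtain ⟨h₁, h₂⟩ := F.val_spec hAx w hφ.2.1 fun y hy => hσ y (.inr hy)
    obtain ⟨d, hd⟩ : ∃ d : S.Var, d = F.toModel.val w σ t := ⟨_, rfl⟩
    rw [← hd] at h₁ h₂
    replace h₁ : d ∈ F.active w := h₁
    have hσ' : ∀ y ∈ φ.fv, y ≠ x → σ y ∈ F.active w := fun y hy e => hσ y (.inl ⟨hy, e⟩)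
    simp only [Model.Sat, Formula.inst]
    rw [← (F.mcs w).assign_congr hAx h₂]
    have hih := ih hφ.2.2 w (σ := Function.update σ x d) fun y hy => by
      by_cases e : y = x
      · subst e; simpa using h₁
      · simpa [e] using hσ' y hy e
    have hup : Function.update (Function.update σ x x) x d = Function.update σ x d := by simp
    have hsub := (F.mcs w).assign_inst_iff hAx hφ.2.2 (x := x) (F.fresh w d h₁)
      (σ := Function.update σ x x) (by simp) fun y hy e => by
        rw [Function.update_of_ne e]
        exact fun h => F.fresh w _ (hσ' y hy e) (h ▸ hφ.1)
    rw [hup] at hsub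
    refine Iff.trans ?_ (hih.trans (hsub.symm.trans ?_))
    · exact iff_of_eq (congrArg (fun τ => F.toModel.Sat w τ φ) (by
        rw [← hd]
        exact congrArg (fun D : DecidableEq S.Var =>
          @Function.update S.Var (fun _ => S.Var) D σ x d) (Subsingleton.elim _ _)))
    · exact iff_of_eq (congrArg (fun τ => assign x (.var d) (φ.inst τ) ∈ F.th w) (by
        funext y; by_cases e : y = x <;> simp [e]))

/-- A formula over `V` that belongs to a world is true there, when its free variables denote
the active variables that are equal to them at this world. -/
theorem exists_sat (hAx : SBELAS S ⊆ Ax) {φ : Formula S} (hφ : φ.Over V) {w : F.World}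
    (h : φ ∈ F.th w) : ∃ σ, F.toModel.Sat w σ φ := by
  have hex : ∀ x, ∃ d, x ∈ φ.fv → d ∈ F.active w ∧ eq (.var d) (.var x) ∈ F.th w := by
    intro x
    by_cases hx : x ∈ φ.fv
    · obtain ⟨d, hd⟩ := F.witness w _ (hφ.var_mem hx)
      exact ⟨d, fun _ => hd⟩
    · exact ⟨x, fun h => (hx h).elim⟩
  choose σ hσ using hex
  exact ⟨σ, (F.sat_iff hAx hφ w fun x hx => (hσ x hx).1).2
    ((F.mcs w).inst_mem hAx hφ (fun x hx => ⟨F.fresh w _ (hσ x hx).1, (hσ x hx).2⟩) h)⟩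

end CanonicalFrame

/-! ### Growing sets of active variables: all Kripke models -/

theorem fv_conj_subset (L : List (Formula S)) :
    (conj L).fv ⊆ (top : Formula S).fv ∪ ⋃ ψ ∈ L, ψ.fv := by
  induction L with
  | nil => exact Set.subset_union_left
  | cons φ L ih =>
    refine Set.union_subset ?_ (ih.trans (Set.union_subset_union_right _ ?_))
    · exact Set.subset_union_of_subset_right
        (Set.subset_biUnion_of_mem (u := Formula.fv) (List.mem_cons_self ..)) _
    · exact Set.biUnion_subset_biUnion_left fun ψ hψ => List.mem_cons_of_mem _ hψ

/-- The variable chosen in the definition of `⊤` occurs in every `conj L` and has to be avoided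
as well. -/
theorem Consistent.insert_eq (hAx : SBELAS S ⊆ Ax) {T : Set (Formula S)} (h : Consistent Ax T)
    {d : S.Var} (hd : ∀ ψ ∈ T, d ∉ ψ.fv) (hd' : d ∉ (top : Formula S).fv) (t : Term S) :
    Consistent Ax (insert (eq (.var d) t) T) := by
  classical
  intro L hL hp
  have hmem : ∀ ψ ∈ L.filter (· ≠ eq (.var d) t), ψ ∈ T := by
    intro ψ hψ
    simp only [List.mem_filter, decide_eq_true_eq] at hψ
    exact (hL ψ hψ.1).resolve_left hψ.2
  refine h _ hmem (Provable.neg_of_neg_and_eq hAx (d := d) (t := t) ?_ (hp.taut_mp hAx ?_))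
  · intro hfv
    rcases fv_conj_subset _ hfv with hfv | hfv
    · exact hd' hfv
    · obtain ⟨ψ, hψ, hfv⟩ := Set.mem_iUnion₂.1 hfv
      exact hd ψ (hmem ψ hψ) hfv
  · intro v hn ha
    simp only [imp, hn, ha, valuation_conj hn ha]
    simp only [List.mem_filter, decide_eq_true_eq]
    rintro ⟨a, b⟩
    apply b
    rintro ⟨hall, he⟩
    refine a fun ψ hψ => ?_
    by_cases e : ψ = eq (.var d) t
    · exact e ▸ he
    · exact hall ψ ⟨hψ, e⟩

theorem Consistent.exists_witnesses (hAx : SBELAS S ⊆ Ax) {T : Set (Formula S)}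
    (h : Consistent Ax T) {A : Set S.Var} (hA : A.Finite) (hT : ∀ ψ ∈ T, ψ.fv ⊆ A)
    {G : Set S.Var} (hG : G.Finite) {ts : Set (Term S)} (hts : ts.Finite) :
    ∃ T', T ⊆ T' ∧ Consistent Ax T' ∧ ∀ t ∈ ts, ∃ d ∉ G, eq (.var d) t ∈ T' := by
  suffices ∃ T', T ⊆ T' ∧ Consistent Ax T' ∧ (∀ t ∈ ts, ∃ d ∉ G, eq (.var d) t ∈ T') ∧
      ∃ B : Set S.Var, B.Finite ∧ ∀ ψ ∈ T', ψ.fv ⊆ B by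
    obtain ⟨T', h₁, h₂, h₃, -⟩ := this
    exact ⟨T', h₁, h₂, h₃⟩
  induction ts, hts using Set.Finite.induction_on with
  | empty => exact ⟨T, subset_rfl, h, by simp, A, hA, hT⟩
  | @insert t ts _ _ ih =>
    obtain ⟨T', hTT', hT', hw, B, hB, hfv⟩ := ih
    obtain ⟨d, hd⟩ := ((hB.union hG).union (top : Formula S).finite_fv).exists_notMem
    simp only [Set.mem_union, not_or] at hd
    refine ⟨insert (eq (.var d) t) T', hTT'.trans (Set.subset_insert _ _),
      hT'.insert_eq hAx (fun ψ hψ hx => hd.1.1 (hfv ψ hψ hx)) hd.2 t, ?_,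
      B ∪ (eq (.var d) t).fv, hB.union (Formula.finite_fv _), ?_⟩
    · rintro t' (rfl | ht')
      · exact ⟨d, hd.1.2, .inl rfl⟩
      · obtain ⟨d', hd', he⟩ := hw t' ht'
        exact ⟨d', hd', .inr he⟩
    · rintro ψ (rfl | hψ)
      · exact Set.subset_union_right
      · exact (hfv ψ hψ).trans Set.subset_union_left

/-- `A` is an irredundant set of variables at `w`, none of which belongs to `V`, and it contains
a variable equal to each term of `V`. -/
structure IsActive (V : Vocabulary S) (w : Set (Formula S)) (A : Set S.Var) : Prop where
  fresh : ∀ d ∈ A, Term.var d ∉ V.terms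
  distinct : ∀ d ∈ A, ∀ d' ∈ A, eq (.var d) (.var d') ∈ w → d = d'
  witness : ∀ t ∈ V.terms, ∃ d ∈ A, eq (.var d) t ∈ w

theorem MCS.exists_isActive {w : Set (Formula S)} (hw : MCS Ax w) (hAx : SBELAS S ⊆ Ax)
    {V : Vocabulary S} (hV : V.terms.Finite) {A : Set S.Var} (hA : A.Finite)
    (hfresh : ∀ d ∈ A, Term.var d ∉ V.terms)
    (hdist : ∀ d ∈ A, ∀ d' ∈ A, eq (.var d) (.var d') ∈ w → d = d')
    (hwit : ∀ t ∈ V.terms, ∃ d, Term.var d ∉ V.terms ∧ eq (.var d) t ∈ w) :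
    ∃ B, A ⊆ B ∧ B.Finite ∧ IsActive V w B := by
  suffices ∀ ts ⊆ V.terms, ts.Finite → ∃ B, A ⊆ B ∧ B.Finite ∧
      (∀ d ∈ B, Term.var d ∉ V.terms) ∧
      (∀ d ∈ B, ∀ d' ∈ B, eq (.var d) (.var d') ∈ w → d = d') ∧
      ∀ t ∈ ts, ∃ d ∈ B, eq (.var d) t ∈ w by
    obtain ⟨B, h₁, h₂, h₃, h₄, h₅⟩ := this _ subset_rfl hV
    exact ⟨B, h₁, h₂, h₃, h₄, h₅⟩
  intro ts hts hfin
  induction ts, hfin using Set.Finite.induction_on with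
  | empty => exact ⟨A, subset_rfl, hA, hfresh, hdist, by simp⟩
  | @insert t ts _ _ ih =>
    obtain ⟨B, hAB, hB, hf, hd, hwB⟩ := ih ((Set.subset_insert _ _).trans hts)
    by_cases ht : ∃ d ∈ B, eq (.var d) t ∈ w
    · refine ⟨B, hAB, hB, hf, hd, ?_⟩
      rintro t' (rfl | ht')
      exacts [ht, hwB t' ht']
    · obtain ⟨e, he, het⟩ := hwit t (hts (Set.mem_insert _ _))
      have hne : ∀ d ∈ B, eq (.var d) (.var e) ∉ w := fun d hdB h =>
        ht ⟨d, hdB, hw.eq_trans hAx h het⟩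
      refine ⟨insert e B, hAB.trans (Set.subset_insert _ _), hB.insert e, ?_, ?_, ?_⟩
      · rintro d (rfl | hd')
        exacts [he, hf d hd']
      · rintro d (rfl | h₁) d' (rfl | h₂) heq
        · rfl
        · exact (hne d' h₂ (hw.eq_symm hAx heq)).elim
        · exact (hne d h₁ heq).elim
        · exact hd d h₁ d' h₂ heq
      · rintro t' (rfl | ht')
        · exact ⟨e, .inl rfl, het⟩
        · obtain ⟨d, hdB, h⟩ := hwB t' ht'
          exact ⟨d, .inr hdB, h⟩

/-- A world with a finite set of active variables, for which fresh variables never run out. -/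
def GrowingWorld (Ax : Set (Formula S)) (V : Vocabulary S) : Type u :=
  {p : Set (Formula S) × Set S.Var // MCS Ax p.1 ∧ p.2.Finite ∧ IsActive V p.1 p.2}

theorem GrowingWorld.exists_of_consistent (hAx : SBELAS S ⊆ Ax) {V : Vocabulary S}
    (hV : V.terms.Finite) {T : Set (Formula S)} (h : Consistent Ax T) {X : Set S.Var}
    (hX : X.Finite) (hT : ∀ ψ ∈ T, ψ.fv ⊆ X) {A : Set S.Var} (hA : A.Finite)
    (hfresh : ∀ d ∈ A, Term.var d ∉ V.terms)
    (hdist : ∀ d ∈ A, ∀ d' ∈ A, d ≠ d' → neg (eq (.var d) (.var d')) ∈ T) :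
    ∃ v : GrowingWorld Ax V, T ⊆ v.1.1 ∧ A ⊆ v.1.2 := by
  have hG : {x : S.Var | Term.var x ∈ V.terms}.Finite :=
    hV.preimage fun x _ y _ e => Term.var.inj e
  obtain ⟨T', hTT', hT', hwit⟩ := h.exists_witnesses hAx hX hT hG hV
  obtain ⟨w, hTw, hw⟩ := hT'.exists_mcs hAx
  obtain ⟨B, hAB, hB, hact⟩ := hw.exists_isActive hAx hV hA hfresh
    (fun d hd d' hd' heq => by
      by_contra hne
      exact (hw.mem_neg hAx).1 (hTw (hTT' (hdist d hd d' hd' hne))) heq)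
    (fun t ht => (hwit t ht).imp fun d hd => ⟨hd.1, hTw hd.2⟩)
  exact ⟨⟨(w, B), hw, hB, hact⟩, hTT'.trans hTw, hAB⟩

/-- The usual existence lemma of modal logic, for a part of the known formulas. -/
theorem MCS.consistent_insert_neg {w : Set (Formula S)} (hw : MCS Ax w) (hAx : SBELAS S ⊆ Ax)
    {i : S.Agent} {χ : Formula S} (hχ : know i χ ∉ w) {T : Set (Formula S)}
    (hT : ∀ ψ ∈ T, know i ψ ∈ w) : Consistent Ax (insert (neg χ) T) := by
  classical
  intro L hL hp
  have hmem : ∀ ψ ∈ (L.filter (· ≠ neg χ)).map (know i), ψ ∈ w := by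
    intro ψ hψ
    simp only [List.mem_map, List.mem_filter, decide_eq_true_eq] at hψ
    obtain ⟨ψ, ⟨hψL, hne⟩, rfl⟩ := hψ
    exact hT ψ ((hL ψ hψL).resolve_left hne)
  have h : Provable Ax (imp (conj (L.filter (· ≠ neg χ))) χ) := by
    refine hp.taut_mp hAx fun v hn ha => ?_
    simp only [imp, hn, ha, valuation_conj hn ha]
    simp only [List.mem_filter, decide_eq_true_eq]
    rintro ⟨a, b⟩
    apply b
    rintro ⟨hall, he⟩
    refine a fun ψ hψ => ?_
    by_cases e : ψ = neg χ
    · rw [e, hn]; exact he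
    · exact hall ψ ⟨hψ, e⟩
  exact hχ (hw.mem_of_imp hAx (.know_mono hAx i h)
    (hw.mem_of_imp hAx (.know_conj hAx i _) ((hw.mem_conj hAx).2 hmem)))

/-- The canonical frame in which successors may have additional active variables. -/
def growingFrame (hAx : SBELAS S ⊆ Ax) {V : Vocabulary S} (hV : V.terms.Finite) :
    CanonicalFrame Ax V where
  World := GrowingWorld Ax V
  th w := w.1.1
  active w := w.1.2
  rel i w v := w.1.2 ⊆ v.1.2 ∧ ∀ ψ : Formula S, ψ.fv ⊆ w.1.2 → know i ψ ∈ w.1.1 → ψ ∈ v.1.1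
  mcs w := w.2.1
  fresh w := w.2.2.2.fresh
  distinct w := w.2.2.2.distinct
  witness w := w.2.2.2.witness
  active_mono h := h.1
  know_mem _ h _ _ _ hσ hK := h.2 _ (fv_inst_subset hσ) hK
  exists_rel := by
    intro i w _ φ σ _ hσ hK
    obtain ⟨⟨w, A⟩, hw, hA, hact⟩ := w
    have hfv : (φ.inst σ).fv ⊆ A := fv_inst_subset hσ
    set T : Set (Formula S) := insert (neg (φ.inst σ)) {ψ | ψ.fv ⊆ A ∧ know i ψ ∈ w}
    have hT : Consistent Ax T := hw.consistent_insert_neg hAx hK fun ψ hψ => hψ.2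
    have hTfv : ∀ ψ ∈ T, ψ.fv ⊆ A := by
      rintro ψ (rfl | hψ)
      exacts [hfv, hψ.1]
    have hdist : ∀ d ∈ A, ∀ d' ∈ A, d ≠ d' → neg (eq (.var d) (.var d')) ∈ T := by
      intro d hd d' hd' hne
      refine .inr ⟨?_, (hw.mem_imp hAx).1 (hw.mem_ax hAx (.rigidN d d' i)) ?_⟩
      · rintro x (hx | hx) <;> rw [Term.vars, Set.mem_singleton_iff] at hx <;> rwa [hx]
      · exact (hw.mem_neg hAx).2 fun h => hne (hact.distinct d hd d' hd' h)
    obtain ⟨v, hTv, hAv⟩ :=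
      GrowingWorld.exists_of_consistent hAx hV hT hA hTfv hA hact.fresh hdist
    exact ⟨v, ⟨hAv, fun ψ hψ hKψ => hTv (.inr ⟨hψ, hKψ⟩)⟩,
      (v.2.1.mem_neg hAx).1 (hTv (.inl rfl))⟩

theorem SBELAS.exists_sat {φ : Formula S} (h : ¬ Provable (SBELAS S) (neg φ)) :
    ∃ (M : Model S) (w : M.World) (σ : S.Var → M.Dom), M.Sat w σ φ := by
  obtain ⟨V, hV, hφ⟩ := φ.exists_over
  have hAx : SBELAS S ⊆ SBELAS S := subset_rfl
  obtain ⟨w, hw, -⟩ := GrowingWorld.exists_of_consistent hAx hV.terms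
    ((consistent_singleton hAx).2 h) φ.finite_fv (by simp) (A := ∅) (by simp) (by simp) (by simp)
  have : Nonempty (growingFrame hAx hV.terms).World := ⟨w⟩
  obtain ⟨σ, hσ⟩ := (growingFrame hAx hV.terms).exists_sat hAx hφ (w := w) (hw rfl)
  exact ⟨_, w, σ, hσ⟩

/-! ### Saturated sets over a countable vocabulary -/

/-- The vocabulary `V` enlarged by the variables in `D`. -/
def Vocabulary.withVars (V : Vocabulary S) (D : Set S.Var) : Vocabulary S where
  terms := V.terms ∪ Term.var '' D
  agents := V.agents
  preds := V.preds

/-- The height of a formula, as a tree. -/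
def Formula.height : Formula S → ℕ
  | .eq _ _ => 0
  | .pred _ _ => 0
  | .and φ ψ => max φ.height ψ.height + 1
  | .neg φ => φ.height + 1
  | .know _ φ => φ.height + 1
  | .assign _ _ φ => φ.height + 1

theorem Vocabulary.countable_over {V : Vocabulary S} (ht : V.terms.Countable)
    (ha : V.agents.Countable) (hp : V.preds.Countable) :
    {φ : Formula S | φ.Over V}.Countable := by
  have key : ∀ n, {φ : Formula S | φ.Over V ∧ φ.height < n}.Countable := by
    intro n
    induction n with
    | zero => simp
    | succ n ih =>
      set X := {φ : Formula S | φ.Over V ∧ φ.height < n}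
      have hv : {x : S.Var | Term.var x ∈ V.terms}.Countable :=
        ht.preimage fun x y e => Term.var.inj e
      have hcount : (Set.image2 Formula.eq V.terms V.terms ∪
          (⋃ P ∈ V.preds, Formula.pred P '' Set.pi Set.univ fun _ => V.terms) ∪
          Set.image2 Formula.and X X ∪ Formula.neg '' X ∪ Set.image2 Formula.know V.agents X ∪
          ⋃ t ∈ V.terms,
            Set.image2 (fun x φ => assign x t φ) {x : S.Var | Term.var x ∈ V.terms} X).Countable :=
        (((((ht.image2 ht _).union (hp.biUnion fun P _ =>
          (Set.countable_univ_pi fun _ => ht).image _)).union (ih.image2 ih _)).union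
          (ih.image _)).union (ha.image2 ih _)).union (ht.biUnion fun t _ => hv.image2 ih _)
      refine hcount.mono ?_
      rintro φ ⟨hφ, hn⟩
      cases φ with
      | eq t t' => exact .inl (.inl (.inl (.inl (.inl ⟨t, hφ.1, t', hφ.2, rfl⟩))))
      | pred P ts =>
        refine .inl (.inl (.inl (.inl (.inr ?_))))
        exact Set.mem_biUnion hφ.1 ⟨ts, fun k _ => hφ.2 k, rfl⟩
      | and φ ψ =>
        simp only [Formula.height] at hn
        exact .inl (.inl (.inl (.inr ⟨φ, ⟨hφ.1, by omega⟩, ψ, ⟨hφ.2, by omega⟩, rfl⟩)))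
      | neg φ =>
        simp only [Formula.height] at hn
        exact .inl (.inl (.inr ⟨φ, ⟨hφ, by omega⟩, rfl⟩))
      | know i φ =>
        simp only [Formula.height] at hn
        exact .inl (.inr ⟨i, hφ.1, φ, ⟨hφ.2, by omega⟩, rfl⟩)
      | assign x t φ =>
        simp only [Formula.height] at hn
        exact .inr (Set.mem_biUnion hφ.2.1 ⟨x, hφ.1, φ, ⟨hφ.2.2, by omega⟩, rfl⟩)
  refine (Set.countable_iUnion key).mono fun φ hφ => ?_
  exact Set.mem_iUnion.2 ⟨φ.height + 1, hφ, Nat.lt_succ_self _⟩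

namespace Formula

/-- The dual of `K_i`. -/
def dia (i : S.Agent) (φ : Formula S) : Formula S := neg (know i (neg φ))

/-- `path [(i₁, χ₁), …, (iₙ, χₙ)] ψ` says that `ψ` holds at the end of some `i₁ … iₙ`-path
through worlds where `χ₁, …, χₙ` hold, the last formula being evaluated together with `ψ`. -/
def path : List (S.Agent × Formula S) → Formula S → Formula S
  | [], ψ => ψ
  | p :: F, ψ => dia p.1 (Formula.and p.2 (path F ψ))

theorem Over.path {V : Vocabulary S} {F : List (S.Agent × Formula S)}
    (hF : ∀ p ∈ F, p.1 ∈ V.agents ∧ p.2.Over V) {ψ : Formula S} (hψ : ψ.Over V) :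
    (Formula.path F ψ).Over V := by
  induction F with
  | nil => exact hψ
  | cons p F ih =>
    rw [List.forall_mem_cons] at hF
    exact ⟨hF.1.1, hF.1.2, ih hF.2⟩

end Formula

/-- A set is saturated if every path formula over the vocabulary in it has a witness: some
variable in `D` denotes the value of `t` at the end of the path. -/
def Saturated (V : Vocabulary S) (D : Set S.Var) (w : Set (Formula S)) : Prop :=
  ∀ F : List (S.Agent × Formula S), (∀ p ∈ F, p.1 ∈ V.agents ∧ p.2.Over (V.withVars D)) →
    ∀ ψ : Formula S, ψ.Over (V.withVars D) → ∀ t ∈ V.terms, path F ψ ∈ w →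
      ∃ d ∈ D, path F (Formula.and ψ (eq (.var d) t)) ∈ w

theorem countable_lists {α : Type*} {s : Set α} (hs : s.Countable) :
    {L : List α | ∀ x ∈ L, x ∈ s}.Countable := by
  have := hs.to_subtype
  have h := Set.countable_range (List.map ((↑) : s → α))
  rwa [Set.range_list_map_coe] at h

/-- A Henkin construction, for an arbitrary consistency property `Good` of the finite stages. -/
theorem exists_saturated (hAx : SBELAS S ⊆ Ax) {V : Vocabulary S} {D : Set S.Var}
    (hC : {φ : Formula S | φ.Over (V.withVars D)}.Countable) (ha : V.agents.Countable)
    (ht : V.terms.Countable) (hne : V.terms.Nonempty) {Good : Formula S → Prop}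
    (hcon : ∀ Ψ, Good Ψ → ¬ Provable Ax (neg Ψ))
    (hstep : ∀ Ψ, Good Ψ → ∀ F : List (S.Agent × Formula S),
      (∀ p ∈ F, p.1 ∈ V.agents ∧ p.2.Over (V.withVars D)) →
      ∀ ψ : Formula S, ψ.Over (V.withVars D) → ∀ t ∈ V.terms,
        Good (Formula.and Ψ (neg (path F ψ))) ∨
          ∃ d ∈ D, Good (Formula.and Ψ (path F (Formula.and ψ (eq (.var d) t)))))
    {Ψ₀ : Formula S} (h₀ : Good Ψ₀) (hΨ₀ : Ψ₀.Over (V.withVars D)) :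
    ∃ w, MCS Ax w ∧ Saturated V D w ∧ Ψ₀ ∈ w ∧
      ∀ χ : Formula S, χ.Over (V.withVars D) → χ ∈ w →
        ∃ Ψ, Good Ψ ∧ Provable Ax (imp Ψ χ) := by
  let Q : Set (List (S.Agent × Formula S) × Formula S × Term S) :=
    {F | ∀ p ∈ F, p ∈ V.agents ×ˢ {φ : Formula S | φ.Over (V.withVars D)}} ×ˢ
      {φ : Formula S | φ.Over (V.withVars D)} ×ˢ V.terms
  have hQ : Q.Countable :=
    (countable_lists (ha.prod hC)).prod (hC.prod ht)
  obtain ⟨t₀, ht₀⟩ := hne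
  have hQne : Q.Nonempty := ⟨([], Ψ₀, t₀), by simp, hΨ₀, ht₀⟩
  obtain ⟨e, he⟩ := hQ.exists_eq_range hQne
  have heQ : ∀ n, e n ∈ Q := fun n => he ▸ Set.mem_range_self n
  have hnext : ∀ (Ψ : {Ψ // Good Ψ}) (n : ℕ), ∃ Ψ' : {Ψ // Good Ψ},
      Provable Ax (imp Ψ'.1 Ψ.1) ∧ (Provable Ax (imp Ψ'.1 (neg (path (e n).1 (e n).2.1))) ∨
        ∃ d ∈ D, Provable Ax
          (imp Ψ'.1 (path (e n).1 (Formula.and (e n).2.1 (eq (.var d) (e n).2.2))))) := by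
    rintro ⟨Ψ, hΨ⟩ n
    have hl : ∀ φ χ : Formula S, Provable Ax (imp (Formula.and φ χ) φ) := fun φ χ =>
      .of_taut hAx fun v hn ha => by simp only [imp, hn, ha]; tauto
    have hr : ∀ φ χ : Formula S, Provable Ax (imp (Formula.and φ χ) χ) := fun φ χ =>
      .of_taut hAx fun v hn ha => by simp only [imp, hn, ha]; tauto
    rcases hstep Ψ hΨ (e n).1 (heQ n).1 (e n).2.1 (heQ n).2.1 (e n).2.2 (heQ n).2.2 with
      h | ⟨d, hd, h⟩
    · exact ⟨⟨_, h⟩, hl _ _, .inl (hr _ _)⟩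
    · exact ⟨⟨_, h⟩, hl _ _, .inr ⟨d, hd, hr _ _⟩⟩
  choose next hnext₁ hnext₂ using hnext
  obtain ⟨stage, hzero, hsucc⟩ : ∃ stage : ℕ → {Ψ // Good Ψ},
      stage 0 = ⟨Ψ₀, h₀⟩ ∧ ∀ n, stage (n + 1) = next (stage n) n :=
    ⟨fun n => Nat.rec ⟨Ψ₀, h₀⟩ (fun n Ψ => next Ψ n) n, rfl, fun _ => rfl⟩
  have hmono : ∀ m n, m ≤ n → Provable Ax (imp (stage n).1 (stage m).1) := by
    intro m n hmn
    induction n, hmn using Nat.le_induction with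
    | base => exact .of_taut hAx fun v hn ha => by simp only [imp, hn, ha]; tauto
    | succ n _ ih =>
      rw [hsucc]
      exact (hnext₁ (stage n) n).taut_mp₂ hAx ih fun v hn ha => by
        simp only [imp, hn, ha]; tauto
  have hcons : Consistent Ax (Set.range fun n => (stage n).1) := by
    intro L hL hp
    have hbound : ∃ n, Provable Ax (imp (stage n).1 (conj L)) := by
      clear hp
      induction L with
      | nil => exact ⟨0, .of_taut hAx fun v hn ha => by simp only [imp, conj, top, hn, ha]; tauto⟩
      | cons φ L ih =>
        rw [List.forall_mem_cons] at hL
        obtain ⟨⟨m, rfl⟩, hL⟩ := hL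
        obtain ⟨n, hn⟩ := ih hL
        refine ⟨max m n, (hmono m _ (le_max_left m n)).taut_mp₃ hAx
          (hmono n _ (le_max_right m n)) hn fun v hn ha => ?_⟩
        simp only [imp, conj, hn, ha]
        tauto
    obtain ⟨n, hn⟩ := hbound
    exact hcon _ (stage n).2 (hn.taut_mp₂ hAx hp fun v hn ha => by
      simp only [imp, hn, ha]; tauto)
  obtain ⟨w, hTw, hw⟩ := hcons.exists_mcs hAx
  have hmem : ∀ n, (stage n).1 ∈ w := fun n => hTw ⟨n, rfl⟩
  have hcase : ∀ F ψ t, (F, ψ, t) ∈ Q → path F ψ ∈ w →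
      ∃ d ∈ D, ∃ n : ℕ, Provable Ax (imp (stage n).1 (path F (Formula.and ψ (eq (.var d) t)))) := by
    intro F ψ t hq hψ
    obtain ⟨n, hn⟩ : (F, ψ, t) ∈ Set.range e := he ▸ hq
    have h := hnext₂ (stage n) n
    rw [← hsucc, hn] at h
    rcases h with h | ⟨d, hd, h⟩
    · exact ((hw.mem_neg hAx).1 (hw.mem_of_imp hAx h (hmem _)) hψ).elim
    · exact ⟨d, hd, n + 1, h⟩
  have hΨ₀w : Ψ₀ ∈ w := by simpa only [hzero] using hmem 0
  refine ⟨w, hw, ?_, hΨ₀w, ?_⟩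
  · intro F hF ψ hψ t ht hpath
    obtain ⟨d, hd, _, h⟩ := hcase F ψ t ⟨hF, hψ, ht⟩ hpath
    exact ⟨d, hd, hw.mem_of_imp hAx h (hmem _)⟩
  · intro χ hχ hχw
    -- The stage that treats `χ` as a path formula of length zero decides `χ`.
    obtain ⟨d, hd, n, h⟩ := hcase [] χ t₀ ⟨by simp, hχ, ht₀⟩ hχw
    exact ⟨_, (stage n).2, h.taut_mp hAx fun v hn ha => by
      simp only [imp, path, hn, ha]; tauto⟩

theorem Formula.Over.eq_var {V : Vocabulary S} {D : Set S.Var} {d : S.Var} (hd : d ∈ D) {t : Term S}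
    (ht : t ∈ V.terms) : (eq (.var d) t : Formula S).Over (V.withVars D) :=
  ⟨.inr ⟨d, hd, rfl⟩, .inl ht⟩

/-- The existence lemma for saturated sets. The stages of the construction of the successor are
the formulas `Ψ` with `⟨i⟩ Ψ` in `u`; saturation of `u` for the longer path provides witnesses. -/
theorem Saturated.exists_successor (hAx : SBELAS S ⊆ Ax) {V : Vocabulary S} {D : Set S.Var}
    (hC : {φ : Formula S | φ.Over (V.withVars D)}.Countable) (ha : V.agents.Countable)
    (ht : V.terms.Countable) (hne : V.terms.Nonempty) {u : Set (Formula S)} (hu : MCS Ax u)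
    (hsat : Saturated V D u) {i : S.Agent} (hi : i ∈ V.agents) {χ : Formula S}
    (hχ : χ.Over (V.withVars D)) (hK : know i χ ∉ u) :
    ∃ v, MCS Ax v ∧ Saturated V D v ∧ χ ∉ v ∧
      ∀ ψ : Formula S, ψ.Over (V.withVars D) → know i ψ ∈ u → ψ ∈ v := by
  have hdia : ∀ φ : Formula S, dia i φ ∈ u ↔ know i (neg φ) ∉ u := fun φ => hu.mem_neg hAx
  let Good : Formula S → Prop := fun Ψ => Ψ.Over (V.withVars D) ∧ dia i Ψ ∈ u
  have hcon : ∀ Ψ, Good Ψ → ¬ Provable Ax (neg Ψ) := fun Ψ hΨ hp =>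
    (hdia Ψ).1 hΨ.2 (hu.mem_of_provable hAx (.necK i _ hp))
  have h₀ : Good (neg χ) := by
    refine ⟨hχ, (hdia _).2 fun h => hK (hu.mem_of_imp hAx (.know_mono hAx i (.of_taut hAx ?_)) h)⟩
    intro v hn ha
    simp only [imp, hn, ha]
    tauto
  have hstep : ∀ Ψ, Good Ψ → ∀ F : List (S.Agent × Formula S),
      (∀ p ∈ F, p.1 ∈ V.agents ∧ p.2.Over (V.withVars D)) →
      ∀ ψ : Formula S, ψ.Over (V.withVars D) → ∀ t ∈ V.terms,
        Good (Formula.and Ψ (neg (path F ψ))) ∨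
          ∃ d ∈ D, Good (Formula.and Ψ (path F (Formula.and ψ (eq (.var d) t)))) := by
    rintro Ψ ⟨hΨo, hΨ⟩ F hF ψ hψ t ht
    by_cases h : dia i (Formula.and Ψ (neg (path F ψ))) ∈ u
    · exact .inl ⟨⟨hΨo, Over.path hF hψ⟩, h⟩
    · right
      have h' : path ((i, Ψ) :: F) ψ ∈ u := by
        by_contra h'
        simp only [path] at h'
        rw [hdia, not_not] at h h'
        refine (hdia Ψ).1 hΨ (hu.mem_of_imp hAx (.know_mono hAx i (.of_taut hAx ?_))
          (hu.mem_of_imp hAx (.know_and hAx i _ _) ((hu.mem_and hAx).2 ⟨h, h'⟩)))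
        intro v hn ha
        simp only [imp, hn, ha]
        tauto
      obtain ⟨d, hd, h⟩ := hsat ((i, Ψ) :: F) (by
        rw [List.forall_mem_cons]; exact ⟨⟨hi, hΨo⟩, hF⟩) ψ hψ t ht h'
      exact ⟨d, hd, ⟨hΨo, Over.path hF ⟨hψ, Over.eq_var hd ht⟩⟩, h⟩
  obtain ⟨v, hv, hvsat, hvχ, hgood⟩ := exists_saturated hAx hC ha ht hne hcon hstep h₀ hχ
  refine ⟨v, hv, hvsat, (hv.mem_neg hAx).1 hvχ, fun ψ hψ hKψ => ?_⟩
  by_contra hn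
  obtain ⟨Ψ, ⟨-, hΨ⟩, hp⟩ := hgood (neg ψ) hψ ((hv.mem_neg hAx).2 hn)
  refine (hdia Ψ).1 hΨ (hu.mem_of_imp hAx (.know_mono hAx i (hp.taut_mp hAx ?_)) hKψ)
  intro v hn ha
  simp only [imp, hn, ha]
  tauto

/-! ### A constant set of active variables: epistemic models -/

theorem SBELAS.subset_SBELAS5 : SBELAS S ⊆ SBELAS5 S := fun φ h => .base φ h

/-- In S5, `⟨i⟩` is left adjoint to `K_i`. -/
theorem SBELAS5.dia_imp_iff {i : S.Agent} {φ ψ : Formula S} :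
    Provable (SBELAS5 S) (imp (dia i φ) ψ) ↔ Provable (SBELAS5 S) (imp φ (know i ψ)) := by
  have hAx := SBELAS.subset_SBELAS5 (S := S)
  constructor
  · intro h
    refine (Provable.ax _ (.t i (neg φ))).taut_mp₃ hAx (.ax _ (.five i (neg φ)))
      (h.know_mono hAx i) fun v hn ha => ?_
    simp only [imp, dia, hn, ha]
    tauto
  · intro h
    have h' : Provable (SBELAS5 S) (imp (neg (know i ψ)) (neg φ)) := by
      refine h.taut_mp hAx fun v hn ha => ?_
      simp only [imp, hn, ha]
      tauto
    refine (Provable.ax _ (.t i ψ)).taut_mp₃ hAx (.ax _ (.five i ψ))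
      (h'.know_mono hAx i) fun v hn ha => ?_
    simp only [imp, dia, hn, ha]
    tauto

/-- A fresh variable may be taken to denote the value of a term at the end of a path: by the
adjunction between `⟨i⟩` and `K_i`, the end of the path can be made the point of evaluation. -/
theorem SBELAS5.imp_neg_path {F : List (S.Agent × Formula S)} {γ ψ : Formula S} {d : S.Var}
    {t : Term S} (hγ : d ∉ γ.fv) (hF : ∀ p ∈ F, d ∉ p.2.fv) (hψ : d ∉ ψ.fv)
    (h : Provable (SBELAS5 S) (imp γ (neg (path F (Formula.and ψ (eq (.var d) t)))))) :
    Provable (SBELAS5 S) (imp γ (neg (path F ψ))) := by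
  have hAx := SBELAS.subset_SBELAS5 (S := S)
  induction F generalizing γ with
  | nil =>
    have h' : Provable (SBELAS5 S) (neg (Formula.and (Formula.and γ ψ) (eq (.var d) t))) := by
      refine h.taut_mp hAx fun v hn ha => ?_
      simp only [imp, path, hn, ha]
      tauto
    refine (Provable.neg_of_neg_and_eq hAx (by rintro (h | h); exacts [hγ h, hψ h])
      h').taut_mp hAx fun v hn ha => ?_
    simp only [imp, path, hn, ha]
    tauto
  | cons p F ih =>
    obtain ⟨i, χ⟩ := p
    rw [List.forall_mem_cons] at hF
    have h₁ : Provable (SBELAS5 S) (imp γ (know i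
        (neg (Formula.and χ (path F (Formula.and ψ (eq (.var d) t))))))) := by
      refine h.taut_mp hAx fun v hn ha => ?_
      simp only [imp, path, dia, hn, ha]
      tauto
    have h₂ := ih (γ := Formula.and (dia i γ) χ) (by rintro (h | h); exacts [hγ h, hF.1 h]) hF.2
      ((SBELAS5.dia_imp_iff.2 h₁).taut_mp hAx fun v hn ha => by
        simp only [imp, hn, ha]
        tauto)
    have h₃ : Provable (SBELAS5 S) (imp γ (know i (neg (Formula.and χ (path F ψ))))) :=
      SBELAS5.dia_imp_iff.1 (h₂.taut_mp hAx fun v hn ha => by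
        simp only [imp, hn, ha]
        tauto)
    refine h₃.taut_mp hAx fun v hn ha => ?_
    simp only [imp, path, dia, hn, ha]
    tauto

theorem SBELAS5.exists_root {V : Vocabulary S} {D : Set S.Var}
    (hC : {φ : Formula S | φ.Over (V.withVars D)}.Countable) (ha : V.agents.Countable)
    (ht : V.terms.Countable) (hne : V.terms.Nonempty) (hD : D.Infinite) {φ : Formula S}
    (hφ : φ.Over (V.withVars D)) (h : ¬ Provable (SBELAS5 S) (neg φ)) :
    ∃ w, MCS (SBELAS5 S) w ∧ Saturated V D w ∧ φ ∈ w := by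
  have hAx := SBELAS.subset_SBELAS5 (S := S)
  suffices hstep : ∀ Ψ : Formula S, ¬ Provable (SBELAS5 S) (neg Ψ) →
      ∀ F : List (S.Agent × Formula S),
      (∀ p ∈ F, p.1 ∈ V.agents ∧ p.2.Over (V.withVars D)) →
      ∀ ψ : Formula S, ψ.Over (V.withVars D) → ∀ t ∈ V.terms,
        ¬ Provable (SBELAS5 S) (neg (Formula.and Ψ (neg (path F ψ)))) ∨ ∃ d ∈ D,
          ¬ Provable (SBELAS5 S) (neg (Formula.and Ψ (path F (Formula.and ψ (eq (.var d) t))))) by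
    obtain ⟨w, h₁, h₂, h₃, -⟩ := exists_saturated hAx hC ha ht hne (fun _ h => h) hstep h hφ
    exact ⟨w, h₁, h₂, h₃⟩
  intro Ψ hΨ F hF ψ hψ t ht
  by_contra! hcon
  obtain ⟨hl, hr⟩ := hcon
  have hfin : (Ψ.fv ∪ (⋃ p ∈ {p | p ∈ F}, p.2.fv) ∪ ψ.fv).Finite :=
    (Ψ.finite_fv.union (F.finite_toSet.biUnion fun p _ => p.2.finite_fv)).union ψ.finite_fv
  obtain ⟨d, hd, hfresh⟩ := hD.exists_notMem_finite hfin
  simp only [Set.mem_union, Set.mem_iUnion, not_or, not_exists] at hfresh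
  have h₁ := SBELAS5.imp_neg_path (F := F) (t := t) hfresh.1.1 (fun p hp => hfresh.1.2 p hp)
    hfresh.2 ((hr d hd).taut_mp hAx fun v hn ha => by
      simp only [imp, hn, ha]
      tauto)
  exact hΨ (hl.taut_mp₂ hAx h₁ fun v hn ha => by
    simp only [imp, hn, ha]
    tauto)

/-- The canonical frame of the saturated sets that agree with `r` on the equations between the
variables in `D`. All its worlds have the same active variables, a set `A` of representatives of
`D` modulo these equations. -/
def epistemicFrame {V : Vocabulary S} {D A : Set S.Var} {r : Set (Formula S)}
    (hC : {φ : Formula S | φ.Over (V.withVars D)}.Countable) (ha : V.agents.Countable)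
    (ht : V.terms.Countable) (hne : V.terms.Nonempty) (hD : ∀ d ∈ D, Term.var d ∉ V.terms)
    (hA : A ⊆ D) (hdist : ∀ d ∈ A, ∀ d' ∈ A, eq (.var d) (.var d') ∈ r → d = d')
    (hrep : ∀ d ∈ D, ∃ d' ∈ A, eq (.var d') (.var d) ∈ r) :
    CanonicalFrame (SBELAS5 S) V where
  World := {w : Set (Formula S) // MCS (SBELAS5 S) w ∧ Saturated V D w ∧
    ∀ d ∈ D, ∀ d' ∈ D, eq (.var d) (.var d') ∈ w ↔ eq (.var d) (.var d') ∈ r}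
  th w := w.1
  active _ := A
  rel i w v := ∀ ψ : Formula S, ψ.Over (V.withVars D) → (know i ψ ∈ w.1 ↔ know i ψ ∈ v.1)
  mcs w := w.2.1
  fresh _ d hd := hD d (hA hd)
  distinct w d hd d' hd' h := hdist d hd d' hd' ((w.2.2.2 d (hA hd) d' (hA hd')).1 h)
  witness := by
    have hAx := SBELAS.subset_SBELAS5 (S := S)
    rintro ⟨w, hw, hsat, heq⟩ t ht
    obtain ⟨d, hd, h⟩ := hsat [] (by simp) (eq t t) ⟨.inl ht, .inl ht⟩ t ht (hw.eq_refl hAx t)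
    obtain ⟨d', hd', h'⟩ := hrep d hd
    exact ⟨d', hd', hw.eq_trans hAx ((heq d' (hA hd') d hd).2 h') ((hw.mem_and hAx).1 h).2⟩
  active_mono _ := subset_rfl
  know_mem := by
    intro i w v hi hwv φ σ hφ hσ hK
    have hφ' : (φ.inst σ).Over (V.withVars D) := hφ.inst (V' := V.withVars D)
      Set.subset_union_left subset_rfl subset_rfl fun x hx => .inr ⟨_, hA (hσ x hx), rfl⟩
    exact v.2.1.mem_of_imp SBELAS.subset_SBELAS5 (.ax _ (.t i _)) ((hwv _ hφ').1 hK)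
  exists_rel := by
    have hAx := SBELAS.subset_SBELAS5 (S := S)
    rintro i ⟨w, hw, hsat, heq⟩ hi φ σ hφ hσ hK
    have hφ' : (φ.inst σ).Over (V.withVars D) := hφ.inst (V' := V.withVars D)
      Set.subset_union_left subset_rfl subset_rfl fun x hx => .inr ⟨_, hA (hσ x hx), rfl⟩
    obtain ⟨v, hv, hvsat, hvφ, hwv⟩ := hsat.exists_successor hAx hC ha ht hne hw hi hφ' hK
    refine ⟨⟨v, hv, hvsat, fun d hd d' hd' => ?_⟩, fun ψ hψ => ?_, hvφ⟩
    · -- Equations and inequations between variables are known.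
      have hover : (eq (.var d) (.var d') : Formula S).Over (V.withVars D) :=
        ⟨.inr ⟨d, hd, rfl⟩, .inr ⟨d', hd', rfl⟩⟩
      rw [← heq d hd d' hd']
      constructor
      · intro h
        by_contra hn
        exact (hv.mem_neg hAx).1 (hwv (neg (eq (.var d) (.var d'))) hover
          ((hw.mem_imp hAx).1 (hw.mem_ax hAx (.rigidN d d' i)) ((hw.mem_neg hAx).2 hn))) h
      · intro h
        exact hwv _ hover ((hw.mem_imp hAx).1 (hw.mem_ax hAx (.rigidP d d' i)) h)
    · -- By positive and negative introspection, `w` and `v` agree on what `i` knows.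
      constructor
      · intro h
        exact hwv (know i ψ) ⟨hi, hψ⟩ (hw.mem_of_imp hAx (.ax _ (.four i ψ)) h)
      · intro h
        by_contra hn
        exact (hv.mem_neg hAx).1 (hwv (neg (know i ψ)) ⟨hi, hψ⟩
          (hw.mem_of_imp hAx (.ax _ (.five i ψ)) ((hw.mem_neg hAx).2 hn))) h

theorem MCS.exists_representatives {w : Set (Formula S)} (hw : MCS Ax w) (hAx : SBELAS S ⊆ Ax)
    (D : Set S.Var) :
    ∃ A ⊆ D, (∀ d ∈ A, ∀ d' ∈ A, eq (.var d) (.var d') ∈ w → d = d') ∧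
      ∀ d ∈ D, ∃ d' ∈ A, eq (.var d') (.var d) ∈ w := by
  let s : Setoid D :=
    { r := fun d d' => eq (.var d) (.var d') ∈ w
      iseqv := ⟨fun _ => hw.eq_refl hAx _, hw.eq_symm hAx, hw.eq_trans hAx⟩ }
  refine ⟨Set.range fun q : Quotient s => (q.out : S.Var), ?_, ?_, ?_⟩
  · rintro _ ⟨q, rfl⟩
    exact q.out.2
  · rintro _ ⟨q, rfl⟩ _ ⟨q', rfl⟩ h
    have : q = q' := by rw [← q.out_eq, ← q'.out_eq]; exact Quotient.sound h
    rw [this]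
  · intro d hd
    exact ⟨_, ⟨Quotient.mk s ⟨d, hd⟩, rfl⟩, Quotient.mk_out (s := s) ⟨d, hd⟩⟩

theorem SBELAS5.exists_sat {φ : Formula S} (h : ¬ Provable (SBELAS5 S) (neg φ)) :
    ∃ M : Model S, M.IsEpistemic ∧ ∃ (w : M.World) (σ : S.Var → M.Dom), M.Sat w σ φ := by
  have hAx := SBELAS.subset_SBELAS5 (S := S)
  obtain ⟨V₀, hV₀, hφ₀⟩ := φ.exists_over
  -- The formula `φ` may lack terms, but the Henkin construction needs one.
  obtain ⟨V, hV, hφ, hne⟩ : ∃ V : Vocabulary S, V.IsFinite ∧ φ.Over V ∧ V.terms.Nonempty :=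
    ⟨V₀.union ⟨{.var (Classical.arbitrary _)}, ∅, ∅⟩, hV₀.union ⟨by simp, by simp, by simp⟩,
      hφ₀.union_left _, _, .inr rfl⟩
  have hinf : {x : S.Var | Term.var x ∈ V.terms}ᶜ.Infinite :=
    (hV.terms.preimage fun x _ y _ e => Term.var.inj e).infinite_compl
  let f := hinf.natEmbedding
  let D : Set S.Var := Set.range fun n => (f n : S.Var)
  have hDinf : D.Infinite := Set.infinite_range_of_injective
    (Subtype.val_injective.comp f.injective)
  have hDV : ∀ d ∈ D, Term.var d ∉ V.terms := by
    rintro _ ⟨n, rfl⟩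
    exact (f n).2
  have ha := hV.agents.countable
  have ht := hV.terms.countable
  have hC : {φ : Formula S | φ.Over (V.withVars D)}.Countable := Vocabulary.countable_over
    (ht.union ((Set.countable_range _).image _)) ha hV.preds.countable
  have hφ' : φ.Over (V.withVars D) := hφ.mono (V' := V.withVars D)
    Set.subset_union_left subset_rfl subset_rfl
  obtain ⟨r, hr, hsat, hφr⟩ := SBELAS5.exists_root hC ha ht hne hDinf hφ' h
  obtain ⟨A, hA, hdist, hrep⟩ := hr.exists_representatives hAx D
  let F := epistemicFrame hC ha ht hne hDV hA hdist hrep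
  let w : F.World := ⟨r, hr, hsat, fun _ _ _ _ => Iff.rfl⟩
  have : Nonempty F.World := ⟨w⟩
  obtain ⟨σ, hσ⟩ := F.exists_sat hAx hφ (w := w) hφr
  refine ⟨F.toModel, fun i => ⟨fun _ _ _ => Iff.rfl, fun h ψ hψ => (h ψ hψ).symm,
    fun h₁ h₂ ψ hψ => (h₁ ψ hψ).trans (h₂ ψ hψ)⟩, w, σ, hσ⟩

end BELAS

theorem mainTheorem1 (S : BELAS.Signature.{u}) :
    BELAS.StronglyComplete (BELAS.SBELAS S) Set.univ ∧
      BELAS.StronglyComplete (BELAS.SBELAS5 S) {M | M.IsEpistemic} := by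
  constructor
  · refine BELAS.stronglyComplete_of_satisfiable subset_rfl (fun _ _ _ => Set.mem_univ _) ?_
    intro φ h
    obtain ⟨M, w, σ, hσ⟩ := BELAS.SBELAS.exists_sat h
    exact ⟨M, Set.mem_univ _, w, σ, hσ⟩
  · refine BELAS.stronglyComplete_of_satisfiable BELAS.SBELAS.subset_SBELAS5
      (fun U M hM => BELAS.Model.ultraproduct_isEpistemic U M hM) ?_
    intro φ h
    obtain ⟨M, hM, w, σ, hσ⟩ := BELAS.SBELAS5.exists_sat h
    exact ⟨M, hM, w, σ, hσ⟩
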